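/- Let $\mathbb K$ be $\mathbb R$ or $\mathbb C$. For $a=(a_n)\in\ell_2(\mathbb K)$ and $t>0$ let $$K_{1,2}(a,t)=\inf\{\|b\|_{1}+t\|c\|_{2} : a=b+c,\ b\in\ell_1,\ c\in\ell_2\}.$$ A sequence $(x_n)$ in a Banach space $E$ over $\mathbb K$ is weakly-$\ell_2$ if $(x^*(x_n))\in\ell_2$ for every $x^*\in E^*$; in this case let $$K^w_{1,2}((x_n),t)=\sup_{x^*\in E^*,\ \|x^*\|\le 1}K_{1,2}\big((x^*(x_n)),t\big).$$ A Rademacher sequence is a sequence $(\varepsilon_n)$ of independent random variables on a probability space with $P(\varepsilon_n=1)=P(\varepsilon_n=-1)=\frac12$. Main Theorem. There is an absolute constant $c>0$ such that the following holds. Let $X=\sum_n\varepsilon_n x_n$ be an almost surely (norm-)convergent Rademacher series with coefficients $x_n$ in a real or complex Banach space $E$. Then $\mathbb E\|X\|<\infty$, the sequence $(x_n)$ is weakly-$\ell_2$, and $K^w_{1,2}((x_n),t)<\infty$ for every $t>0$. Moreover, for every $t>0$, $$P\big(\|X\|>2\,\mathbb E\|X\|+6K^w_{1,2}((x_n),t)\big)\le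 4e^{-t^2/8},$$ and, if the $x_n$ are not all zero, $$P\big(\|X\|>\tfrac12\,\mathbb E\|X\|+cK^w_{1,2}((x_n),t)\big)\ge c\,e^{-t^2/c}.$$ -/

import Mathlib

open Filter Topology MeasureTheory ProbabilityTheory
open scoped ENNReal

/-- A Rademacher sequence on a probability space: independent random variables, each taking
the values `1` and `-1` with probability `1/2`. -/
structure IsRademacherSequence {Ω : Type*} [MeasurableSpace Ω] (P : Measure Ω)
    (ε : ℕ → Ω → ℝ) : Prop where
  measurable : ∀ n, Measurable (ε n)
  indep : iIndepFun ε P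
  prob_one : ∀ n, P {ω | ε n ω = 1} = 1 / 2
  prob_neg_one : ∀ n, P {ω | ε n ω = -1} = 1 / 2

/-- The Rademacher series `∑ ε n • x n` converges almost surely, in the norm of `E`,
to the random vector `X`. -/
def IsRademacherSum (𝕜 : Type*) [RCLike 𝕜] {E : Type*} [NormedAddCommGroup E]
    [NormedSpace 𝕜 E] {Ω : Type*} [MeasurableSpace Ω] (P : Measure Ω)
    (ε : ℕ → Ω → ℝ) (x : ℕ → E) (X : Ω → E) : Prop :=
  ∀ᵐ ω ∂P, Tendsto (fun N : ℕ => ∑ n ∈ Finset.range N, ((ε n ω : ℝ) : 𝕜) • x n)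
    atTop (𝓝 (X ω))

/-- The K-functional `K(a, t; ℓ₁, ℓ₂)` of a scalar sequence: the infimum of `‖b‖₁ + t ‖c‖₂` over
all decompositions `a = b + c` with `b ∈ ℓ₁` and `c ∈ ℓ₂`. -/
noncomputable def kFunctional12 {𝕜 : Type*} [RCLike 𝕜] (a : ℕ → 𝕜) (t : ℝ) : ℝ :=
  sInf {r : ℝ | ∃ (b : lp (fun _ : ℕ => 𝕜) 1) (c : lp (fun _ : ℕ => 𝕜) 2),
    (∀ n, a n = b n + c n) ∧ r = ‖b‖ + t * ‖c‖}

/-- The sequence `x` is weakly-`ℓ₂`: all its images under continuous functionals are in `ℓ₂`. -/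
def IsWeaklyL2 (𝕜 : Type*) [RCLike 𝕜] {E : Type*} [NormedAddCommGroup E]
    [NormedSpace 𝕜 E] (x : ℕ → E) : Prop :=
  ∀ f : StrongDual 𝕜 E, Memℓp (fun n => f (x n)) 2

/-- The weak K-functional: the supremum of `K(f (x n), t; ℓ₁, ℓ₂)` over the closed unit ball of
the dual space. -/
noncomputable def weakKFunctional12 (𝕜 : Type*) [RCLike 𝕜] {E : Type*} [NormedAddCommGroup E]
    [NormedSpace 𝕜 E] (x : ℕ → E) (t : ℝ) : ℝ :=
  ⨆ f : {f : StrongDual 𝕜 E // ‖f‖ ≤ 1}, kFunctional12 (fun n => f.1 (x n)) t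

/-!
Passing to the limit in the partial sums `S_N = ∑_{n < N} ε n • x n` reduces both tail estimates
to finite sums, that is, to functions on the cube `{-1, 1}ᴺ` with the uniform measure
(`IsRademacherSequence.map_signCode`). Throughout, `K` is the weak K-functional at `t`.

Upper tail. By Talagrand's convex-set inequality (`exists_exp_sq_dist_convex_le`, proved by
induction on the dimension), outside a set of probability `2 exp (-t² / 8)` a sign vector can be
moved by some `d` with `‖d‖_∞ ≤ 2` and `‖d‖₂ ≤ t` into the convex hull of `{‖S_N‖ ≤ 2 𝔼‖X‖}`,
which has probability at least `1/2`. By Hahn–Banach and the definition of the K-functional, such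
a `d` changes the norm of the sum by at most `2 K`
(`norm_sum_smul_le_two_mul_weakKFunctional12`).

Moments. If `‖S_N‖ ≤ R` with probability above `13/16`, the scalar Paley–Zygmund inequality bounds
`∑ |f (x n)|²` by a multiple of `R²` for all `‖f‖ ≤ 1`, and then Talagrand's inequality bounds
`𝔼‖S_N‖²` by a multiple of `R²` (`IsRademacherSequence.integral_norm_sq_le_of_measureReal_lt`).
With `R` from almost sure boundedness of the partial sums, this gives boundedness in `L²`, hence
integrability of the limit, and the weak `ℓ₂` property; with `R` a multiple of `𝔼‖X‖` it gives
`𝔼‖X‖² ≤ C (𝔼‖X‖)²`.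

Lower tail. For real coefficients `a` and `m` about `t²`, the index set contains at most `m`
disjoint blocks whose `ℓ₂` norms sum to a multiple of `K(a, t)`. Each block sum exceeds half its
standard deviation with probability at least `3/32`, independently of the others, so the whole sum
exceeds a multiple of `K(a, t)` with probability exponential in `-t²`
(`IsRademacherSequence.exists_pow_le_measureReal`). Applied to the real and imaginary parts of
`f (x n)`, `n < N`, for a nearly optimal `f` and large `N`, this bounds the tail of `‖S_N‖` below;
reversing the signs with index at least `N` shows that longer sums inherit at least half of it
(`IsRademacherSequence.measureReal_norm_gt_le`). So `‖X‖` exceeds a multiple of `K`, which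
suffices when `K` dominates `𝔼‖X‖`. Otherwise the Paley–Zygmund inequality for `‖X‖` applies.
-/

/-! ### Talagrand's inequality on the cube -/

/-- The sign `1` or `-1` encoded by a Boolean; the discrete cube `{-1, 1}ⁿ` is encoded
by `Fin n → Bool`. -/
def boolSign (b : Bool) : ℝ := if b then 1 else -1

lemma boolSign_sq (b : Bool) : boolSign b ^ 2 = 1 := by cases b <;> simp [boolSign]

lemma abs_boolSign (b : Bool) : |boolSign b| = 1 := by cases b <;> simp [boolSign]

lemma boolSign_not (b : Bool) : boolSign (!b) = -boolSign b := by cases b <;> simp [boolSign]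

/-- Splitting a sum over the cube along the first coordinate, with the slice `b` listed first. -/
lemma sum_cube_succ {M : Type*} [AddCommMonoid M] (n : ℕ) (F : (Fin (n + 1) → Bool) → M)
    (b : Bool) :
    ∑ v, F v =
      ∑ w : Fin n → Bool, F (Fin.cons b w) + ∑ w : Fin n → Bool, F (Fin.cons (!b) w) := by
  rw [← (Fin.consEquiv (fun _ : Fin (n + 1) => Bool)).sum_comp, Fintype.sum_prod_type,
    Fintype.sum_bool]
  cases b
  · rw [add_comm]; rfl
  · rfl

/-- This is `y ≤ sinh y` at `y = -log u`. -/
lemma neg_mul_log_le {u : ℝ} (hu : 0 < u) (hu1 : u ≤ 1) : -(u * Real.log u) ≤ (1 - u ^ 2) / 2 := by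
  have h1 : -Real.log u ≤ Real.sinh (-Real.log u) :=
    Real.self_le_sinh_iff.2 (by linarith [Real.log_nonpos hu.le hu1])
  rw [Real.sinh_eq, neg_neg, Real.exp_neg, Real.exp_log hu] at h1
  have h2 := mul_le_mul_of_nonneg_left h1 hu.le
  have h3 : u * ((u⁻¹ - u) / 2) = (1 - u ^ 2) / 2 := by field_simp
  linarith

/-- The numerical inequality that closes the induction step in Talagrand's inequality. -/
lemma one_add_mul_one_add_exp_le {u : ℝ} (hu : 0 ≤ u) (hu1 : u ≤ 1) :
    (1 + u) * (1 + Real.exp (1 - u)) ≤ 4 := by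
  set x : ℝ := (1 - u) / 2 with hx
  have hx0 : 0 ≤ x := by rw [hx]; linarith
  have hx1 : x ≤ 1 / 2 := by rw [hx]; linarith
  -- `2 x ≤ log ((1 + x) / (1 - x))` is the first term of the power series
  have h := Real.hasSum_log_sub_log_of_abs_lt_one (x := x) (by rw [abs_of_nonneg hx0]; linarith)
  have h2 := le_hasSum h 0 (fun k _ => by positivity)
  norm_num at h2
  rw [← Real.log_div (by linarith) (by linarith)] at h2
  have h3 := Real.exp_le_exp.2 h2
  rw [Real.exp_log (by apply div_pos <;> linarith), le_div_iff₀ (by linarith)] at h3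
  have h4 : 2 * x = 1 - u := by rw [hx]; ring
  rw [h4, hx] at h3
  nlinarith

/-- Weighted Hölder inequality for exponentials, with prescribed bounds for the two factors. -/
lemma sum_exp_convex_comb_le {ι : Type*} [Fintype ι] (α β : ι → ℝ) {p q l m : ℝ} (hp : 0 < p)
    (hq : 0 < q) (hl : 0 ≤ l) (hm : 0 ≤ m) (hlm : l + m = 1) (hα : ∑ i, Real.exp (α i) ≤ p)
    (hβ : ∑ i, Real.exp (β i) ≤ q) :
    ∑ i, Real.exp (l * α i + m * β i) ≤ Real.exp (l * Real.log p + m * Real.log q) := by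
  have key : ∀ i, Real.exp (l * α i + m * β i) ≤ Real.exp (l * Real.log p + m * Real.log q) *
      (l * (Real.exp (α i) / p) + m * (Real.exp (β i) / q)) := by
    intro i
    have h := convexOn_exp.2 (Set.mem_univ (α i - Real.log p)) (Set.mem_univ (β i - Real.log q))
      hl hm hlm
    simp only [smul_eq_mul, Real.exp_sub, Real.exp_log hp, Real.exp_log hq] at h
    refine le_trans (le_of_eq ?_) (mul_le_mul_of_nonneg_left h (Real.exp_pos _).le)
    rw [← Real.exp_add]
    congr 1
    ring
  refine (Finset.sum_le_sum fun i _ => key i).trans ?_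
  rw [← Finset.mul_sum]
  refine mul_le_of_le_one_right (Real.exp_pos _).le ?_
  rw [Finset.sum_add_distrib, ← Finset.mul_sum, ← Finset.mul_sum, ← Finset.sum_div,
    ← Finset.sum_div, ← hlm]
  gcongr
  · exact mul_le_of_le_one_right hl ((div_le_one hp).2 hα)
  · exact mul_le_of_le_one_right hm ((div_le_one hq).2 hβ)

/-- Talagrand's concentration inequality for convex sets on the cube. Every point `v` of the
cube is assigned a point `η v` of the convex hull of `A` (expressed as membership in every
convex set containing `A`), so that `exp (‖v - η v‖² / 8)` has mean at most `1 / P(A)`. -/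
theorem exists_exp_sq_dist_convex_le (n : ℕ) (A : Finset (Fin n → Bool)) (hA : A.Nonempty) :
    ∃ η : (Fin n → Bool) → Fin n → ℝ,
      (∀ C : Set (Fin n → ℝ), Convex ℝ C → (∀ w ∈ A, (fun i => boolSign (w i)) ∈ C) →
        ∀ v, η v ∈ C) ∧
      (∑ v, Real.exp ((∑ i, (boolSign (v i) - η v i) ^ 2) / 8)) * A.card ≤ 4 ^ n := by
  induction n with
  | zero =>
    refine ⟨fun _ => 0, fun C _ h v => ?_, ?_⟩
    · obtain ⟨w, hw⟩ := hA
      convert h w hw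
    · have := A.card_le_univ
      simp only [Fintype.card_pi, Finset.univ_eq_empty, Finset.prod_empty] at this
      simpa using this
  | succ n ih =>
    let sec : Bool → Finset (Fin n → Bool) := fun b =>
      Finset.univ.filter fun w => (Fin.cons b w : Fin (n + 1) → Bool) ∈ A
    have hcard : ∀ b, A.card = (sec b).card + (sec (!b)).card := by
      intro b
      have := sum_cube_succ n (fun v => if v ∈ A then 1 else 0) b
      rw [← Finset.card_filter, Finset.filter_univ_mem] at this
      simpa only [sec, Finset.card_filter] using this
    obtain ⟨b, hb⟩ : ∃ b, (sec (!b)).card ≤ (sec b).card := by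
      rcases le_total (sec true).card (sec false).card with h | h
      · exact ⟨false, h⟩
      · exact ⟨true, h⟩
    have hcard := hcard b
    have hApos := hA.card_pos
    have hne : (sec b).Nonempty := Finset.card_pos.1 (by omega)
    obtain ⟨η₁, hη₁, hs₁⟩ := ih (sec b) hne
    -- slices of convex sets are convex, so `η₁` lands in the slice
    have hslice : ∀ (b : Bool) (C : Set (Fin (n + 1) → ℝ)), Convex ℝ C →
        Convex ℝ {y : Fin n → ℝ | (Fin.cons (boolSign b) y : Fin (n + 1) → ℝ) ∈ C} := by
      intro b C hC y hy z hz s t hs ht hst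
      have := hC hy hz hs ht hst
      simp only [Set.mem_ofPred_eq] at this ⊢
      convert this using 1
      ext i
      refine Fin.cases ?_ (fun i => ?_) i
      · simp [← add_mul, hst]
      · simp
    have hsec : ∀ (b : Bool) (C : Set (Fin (n + 1) → ℝ)),
        (∀ w ∈ A, (fun i => boolSign (w i)) ∈ C) → ∀ w ∈ sec b,
          (fun i => boolSign (w i)) ∈
            {y : Fin n → ℝ | (Fin.cons (boolSign b) y : Fin (n + 1) → ℝ) ∈ C} := by
      intro b C hC w hw
      have := hC _ (by simpa [sec] using hw)
      simp only [Set.mem_ofPred_eq]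
      convert this using 1
      ext i
      refine Fin.cases ?_ (fun i => ?_) i <;> simp
    set p : ℝ := ((sec b).card : ℝ) with hp
    set q : ℝ := ((sec (!b)).card : ℝ) with hq
    have hp0 : 0 < p := by rw [hp]; exact_mod_cast hne.card_pos
    have hqp : q ≤ p := by rw [hp, hq]; exact_mod_cast hb
    have hpq : (A.card : ℝ) = p + q := by rw [hcard]; push_cast; rfl
    clear_value p q
    rw [hpq]
    have h4 : (0 : ℝ) < 4 ^ n := by positivity
    rcases Nat.eq_zero_or_pos (sec (!b)).card with h0 | h0
    -- if the other slice is empty, all points are projected to the slice `b`, at cost `2² / 8`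
    · refine ⟨fun v => Fin.cons (boolSign b) (η₁ (Fin.tail v)), fun C hC hAC v =>
        hη₁ _ (hslice b C hC) (hsec b C hAC) _, ?_⟩
      have hq0 : q = 0 := by rw [hq, h0]; simp
      rw [sum_cube_succ n _ b]
      simp only [Fin.sum_univ_succ, Fin.cons_zero, Fin.cons_succ, Fin.tail_cons, boolSign_not,
        sub_self]
      have h5 : ∀ y : ℝ, Real.exp (((-boolSign b - boolSign b) ^ 2 + y) / 8) =
          Real.exp (1 / 2) * Real.exp (y / 8) := by
        intro y
        rw [← Real.exp_add]
        congr 1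
        linear_combination (1 / 2) * boolSign_sq b
      simp only [h5, ← Finset.mul_sum]
      have h6 : Real.exp (1 / 2) ≤ 3 :=
        (Real.exp_le_exp.2 (by norm_num)).trans (Real.exp_one_lt_d9.le.trans (by norm_num))
      rw [hq0]
      simp only [ne_eq, OfNat.ofNat_ne_zero, not_false_eq_true, zero_pow, zero_add, add_zero]
      calc _ = (1 + Real.exp (1 / 2)) * ((∑ v, Real.exp ((∑ i, (boolSign (v i) - η₁ v i) ^ 2) / 8)) * p) := by
            ring
        _ ≤ 4 * 4 ^ n := by
            apply mul_le_mul (by linarith) hs₁ (by positivity) (by norm_num)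
        _ = 4 ^ (n + 1) := by ring
    · obtain ⟨η₂, hη₂, hs₂⟩ := ih (sec (!b)) (Finset.card_pos.1 h0)
      have hq0 : 0 < q := by rw [hq]; exact_mod_cast h0
      set u : ℝ := q / p with hu
      have hu0 : 0 < u := div_pos hq0 hp0
      have hu1 : u ≤ 1 := (div_le_one hp0).2 hqp
      have hqu : q = u * p := by rw [hu]; field_simp
      -- on the larger slice keep `η₁`, on the other one mix with weights `1 - u` and `u`
      let l : Bool → ℝ := fun c => if c = b then 1 else 1 - u
      have hl0 : ∀ c, 0 ≤ l c := fun c => by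
        by_cases h : c = b <;> simp [l, h, hu1]
      have hl1 : ∀ c, 0 ≤ 1 - l c := fun c => by
        by_cases h : c = b <;> simp [l, h, hu0.le]
      refine ⟨fun v => l (v 0) • (Fin.cons (boolSign b) (η₁ (Fin.tail v)) : Fin (n + 1) → ℝ) +
        (1 - l (v 0)) • (Fin.cons (boolSign (!b)) (η₂ (Fin.tail v)) : Fin (n + 1) → ℝ),
        fun C hC hAC v => hC (hη₁ _ (hslice b C hC) (hsec b C hAC) _)
          (hη₂ _ (hslice (!b) C hC) (hsec (!b) C hAC) _) (hl0 _) (hl1 _) (by ring), ?_⟩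
      rw [sum_cube_succ n _ b]
      have hlb : l b = 1 := by simp [l]
      have hlb' : l (!b) = 1 - u := if_neg (by cases b <;> decide)
      simp only [Fin.sum_univ_succ, Fin.cons_zero, Fin.cons_succ, Fin.tail_cons, boolSign_not,
        Pi.add_apply, Pi.smul_apply, smul_eq_mul, hlb, hlb']
      set P : ℝ := 4 ^ n / p with hP
      set Q : ℝ := 4 ^ n / q with hQ
      have hP0 : 0 < P := div_pos h4 hp0
      have hQ0 : 0 < Q := div_pos h4 hq0
      have e1 : ∑ v, Real.exp ((∑ i, (boolSign (v i) - η₁ v i) ^ 2) / 8) ≤ P := by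
        rw [hP, le_div_iff₀ hp0]; exact hs₁
      have e2 : ∑ v, Real.exp ((∑ i, (boolSign (v i) - η₂ v i) ^ 2) / 8) ≤ Q := by
        rw [hQ, le_div_iff₀ hq0, hq]; exact hs₂
      have e3 := sum_exp_convex_comb_le _ _ hP0 hQ0 (sub_nonneg.2 hu1) hu0.le (by ring) e1 e2
      have hlogQ : Real.log Q = Real.log P - Real.log u := by
        rw [← Real.log_div hP0.ne' hu0.ne']
        congr 1
        rw [hP, hQ, hqu]; field_simp
      have e4 : (1 - u) * Real.log P + u * Real.log Q = Real.log P + -(u * Real.log u) := by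
        rw [hlogQ]; ring
      rw [e4, Real.exp_add, Real.exp_log hP0] at e3
      have e5 : ∑ v : Fin n → Bool, Real.exp (((-boolSign b - ((1 - u) * boolSign b +
            (1 - (1 - u)) * -boolSign b)) ^ 2 + ∑ i, (boolSign (v i) - ((1 - u) * η₁ v i +
            (1 - (1 - u)) * η₂ v i)) ^ 2) / 8) ≤ P * Real.exp (1 - u) := by
        calc _ ≤ ∑ v : Fin n → Bool, Real.exp ((1 - u) ^ 2 / 2) *
              Real.exp ((1 - u) * ((∑ i, (boolSign (v i) - η₁ v i) ^ 2) / 8) +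
              u * ((∑ i, (boolSign (v i) - η₂ v i) ^ 2) / 8)) := by
              refine Finset.sum_le_sum fun v _ => ?_
              rw [← Real.exp_add, Real.exp_le_exp]
              have : ∑ i, (boolSign (v i) - ((1 - u) * η₁ v i + (1 - (1 - u)) * η₂ v i)) ^ 2 ≤
                  (1 - u) * (∑ i, (boolSign (v i) - η₁ v i) ^ 2) +
                  u * (∑ i, (boolSign (v i) - η₂ v i) ^ 2) := by
                rw [Finset.mul_sum, Finset.mul_sum, ← Finset.sum_add_distrib]
                refine Finset.sum_le_sum fun i _ => ?_
                have := mul_nonneg (mul_nonneg hu0.le (sub_nonneg.2 hu1))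
                  (sq_nonneg (η₁ v i - η₂ v i))
                linarith
              have h7 := boolSign_sq b
              have h8 : (-boolSign b - ((1 - u) * boolSign b + (1 - (1 - u)) * -boolSign b)) ^ 2
                  = 4 * (1 - u) ^ 2 := by linear_combination 4 * (1 - u) ^ 2 * h7
              rw [h8]
              linarith
          _ ≤ Real.exp ((1 - u) ^ 2 / 2) * (P * Real.exp (-(u * Real.log u))) := by
              rw [← Finset.mul_sum]
              exact mul_le_mul_of_nonneg_left e3 (Real.exp_pos _).le
          _ = P * Real.exp ((1 - u) ^ 2 / 2 + -(u * Real.log u)) := by rw [Real.exp_add]; ring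
          _ ≤ P * Real.exp (1 - u) := by
              gcongr
              linarith [neg_mul_log_le hu0 hu1]
      simp only [sub_self, zero_mul, add_zero, one_mul, ne_eq, OfNat.ofNat_ne_zero,
        not_false_eq_true, zero_pow, zero_add]
      calc _ ≤ (P + P * Real.exp (1 - u)) * (p + q) := by gcongr
        _ = (P * p) * ((1 + u) * (1 + Real.exp (1 - u))) := by rw [hqu]; ring
        _ ≤ 4 ^ n * 4 := by
            have : P * p = 4 ^ n := by rw [hP]; field_simp
            rw [this]
            gcongr
            exact one_add_mul_one_add_exp_le hu0.le hu1
        _ = 4 ^ (n + 1) := by ring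

/-! ### Rademacher sums on the cube -/

lemma sum_cube_sq (n : ℕ) (a : Fin n → ℝ) :
    ∑ v : Fin n → Bool, (∑ i, boolSign (v i) * a i) ^ 2 = 2 ^ n * ∑ i, a i ^ 2 := by
  induction n with
  | zero => simp
  | succ n ih =>
    rw [sum_cube_succ n _ true, ← Finset.sum_add_distrib]
    simp only [Fin.sum_univ_succ, Fin.cons_zero, Fin.cons_succ]
    have h : ∀ w : Fin n → Bool, (boolSign true * a 0 + ∑ i, boolSign (w i) * a i.succ) ^ 2 +
        (boolSign (!true) * a 0 + ∑ i, boolSign (w i) * a i.succ) ^ 2 =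
        2 * a 0 ^ 2 + 2 * (∑ i, boolSign (w i) * a i.succ) ^ 2 := by
      intro w; simp [boolSign]; ring
    simp only [h, Finset.sum_add_distrib, ← Finset.mul_sum, ih fun i => a i.succ]
    simp
    ring

lemma sum_cube_pow_four_le (n : ℕ) (a : Fin n → ℝ) :
    ∑ v : Fin n → Bool, (∑ i, boolSign (v i) * a i) ^ 4 ≤ 2 ^ n * (3 * (∑ i, a i ^ 2) ^ 2) := by
  induction n with
  | zero => simp
  | succ n ih =>
    rw [sum_cube_succ n _ true, ← Finset.sum_add_distrib]
    simp only [Fin.sum_univ_succ, Fin.cons_zero, Fin.cons_succ]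
    have h : ∀ w : Fin n → Bool, (boolSign true * a 0 + ∑ i, boolSign (w i) * a i.succ) ^ 4 +
        (boolSign (!true) * a 0 + ∑ i, boolSign (w i) * a i.succ) ^ 4 =
        2 * a 0 ^ 4 + (12 * a 0 ^ 2) * (∑ i, boolSign (w i) * a i.succ) ^ 2 +
          2 * (∑ i, boolSign (w i) * a i.succ) ^ 4 := by
      intro w; simp [boolSign]; ring
    simp only [h, Finset.sum_add_distrib, ← Finset.mul_sum, sum_cube_sq]
    have h2 := ih fun i => a i.succ
    have h3 : (0 : ℝ) ≤ 2 ^ n * a 0 ^ 4 := by positivity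
    simp only [Finset.sum_const, Finset.card_univ, Fintype.card_pi, Fintype.card_bool,
      Finset.prod_const, Fintype.card_fin, nsmul_eq_mul, Nat.cast_pow, Nat.cast_ofNat]
    rw [pow_succ (2 : ℝ) n]
    nlinarith

/-- Paley–Zygmund inequality for a scalar Rademacher sum on the cube. -/
lemma card_cube_sq_ge (n : ℕ) (a : Fin n → ℝ) :
    3 / 16 * (2 : ℝ) ^ n ≤ (Finset.univ.filter fun v : Fin n → Bool =>
      (∑ i, a i ^ 2) / 4 ≤ (∑ i, boolSign (v i) * a i) ^ 2).card := by
  set s := ∑ i, a i ^ 2 with hs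
  have hs0 : 0 ≤ s := Finset.sum_nonneg fun i _ => sq_nonneg _
  rcases hs0.eq_or_lt with h0 | h0
  · rw [Finset.filter_true_of_mem]
    · simp only [Finset.card_univ, Fintype.card_pi, Fintype.card_bool,
        Finset.prod_const, Fintype.card_fin, Nat.cast_pow, Nat.cast_ofNat]
      have : (0 : ℝ) < 2 ^ n := by positivity
      linarith
    · intro v _
      rw [← h0, zero_div]
      exact sq_nonneg _
  -- `y² ≤ s / 4 + y⁴ / (8 s)` wherever the event fails, and `y² ≤ 2 s + y⁴ / (8 s)` always
  have key : ∀ v : Fin n → Bool, (∑ i, boolSign (v i) * a i) ^ 2 ≤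
      s / 4 + 1 / (8 * s) * (∑ i, boolSign (v i) * a i) ^ 4 +
        2 * s * (if s / 4 ≤ (∑ i, boolSign (v i) * a i) ^ 2 then 1 else 0) := by
    intro v
    set y := ∑ i, boolSign (v i) * a i
    have h1 : 0 ≤ 1 / (8 * s) * (y ^ 2 - 4 * s) ^ 2 := by positivity
    have h2 : 1 / (8 * s) * (y ^ 2 - 4 * s) ^ 2 = 1 / (8 * s) * y ^ 4 - y ^ 2 + 2 * s := by
      field_simp; ring
    have h3 : 0 ≤ 1 / (8 * s) * y ^ 4 := by positivity
    split_ifs with h <;> linarith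
  have h := Finset.sum_le_sum fun v (_ : v ∈ Finset.univ) => key v
  rw [sum_cube_sq, Finset.sum_add_distrib, Finset.sum_add_distrib, ← Finset.mul_sum,
    ← Finset.mul_sum, Finset.sum_boole, ← hs] at h
  have h4 := mul_le_mul_of_nonneg_left (sum_cube_pow_four_le n a)
    (by positivity : 0 ≤ 1 / (8 * s))
  rw [← hs] at h4
  have h5 : 1 / (8 * s) * (2 ^ n * (3 * s ^ 2)) = 3 / 8 * 2 ^ n * s := by field_simp
  simp only [Finset.sum_const, Finset.card_univ, Fintype.card_pi, Fintype.card_bool,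
    Finset.prod_const, Fintype.card_fin, nsmul_eq_mul, Nat.cast_pow, Nat.cast_ofNat] at h
  refine le_of_mul_le_mul_left (a := 2 * s) ?_ (by positivity)
  linarith

/-- The symmetry of the cube that reverses the signs with indices outside `J`. -/
def flipOutside {n : ℕ} (J : Finset (Fin n)) : Equiv.Perm (Fin n → Bool) :=
  Function.Involutive.toPerm (fun v i => if i ∈ J then v i else !(v i)) (by
    intro v; ext i; by_cases h : i ∈ J <;> simp [h])

lemma flipOutside_apply {n : ℕ} (J : Finset (Fin n)) (v : Fin n → Bool) (i : Fin n) :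
    flipOutside J v i = if i ∈ J then v i else !(v i) := rfl

lemma card_cube_flipOutside {n : ℕ} (J : Finset (Fin n)) (p : (Fin n → Bool) → Prop)
    [DecidablePred p] :
    (Finset.univ.filter fun v => p (flipOutside J v)).card = (Finset.univ.filter p).card := by
  rw [Finset.card_filter, Finset.card_filter]
  exact Equiv.sum_comp (flipOutside J) fun v => if p v then 1 else 0

/-- One-sided form of the Paley–Zygmund inequality, by symmetry. -/
lemma card_cube_ge (n : ℕ) (a : Fin n → ℝ) :
    3 / 32 * (2 : ℝ) ^ n ≤ (Finset.univ.filter fun v : Fin n → Bool =>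
      √(∑ i, a i ^ 2) / 2 ≤ ∑ i, boolSign (v i) * a i).card := by
  have h := card_cube_sq_ge n a
  set s := ∑ i, a i ^ 2 with hs
  have hs0 : 0 ≤ s := Finset.sum_nonneg fun i _ => sq_nonneg _
  let p : (Fin n → Bool) → Prop := fun v => √s / 2 ≤ ∑ i, boolSign (v i) * a i
  have hflip := card_cube_flipOutside ∅ p
  have hsub : (Finset.univ.filter fun v : Fin n → Bool =>
      s / 4 ≤ (∑ i, boolSign (v i) * a i) ^ 2) ⊆
      (Finset.univ.filter p) ∪ (Finset.univ.filter fun v => p (flipOutside ∅ v)) := by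
    intro v hv
    simp only [Finset.mem_union, Finset.mem_filter, Finset.mem_univ, true_and, p,
      flipOutside_apply, Finset.notMem_empty, if_false, boolSign_not, neg_mul,
      Finset.sum_neg_distrib] at hv ⊢
    rw [← le_abs]
    refine abs_le_of_sq_le_sq' ?_ (abs_nonneg _) |>.2
    rw [sq_abs, div_pow, Real.sq_sqrt hs0]
    linarith
  have h2 := (Finset.card_le_card hsub).trans (Finset.card_union_le _ _)
  rw [hflip] at h2
  have h3 : ((Finset.univ.filter fun v : Fin n → Bool =>
      s / 4 ≤ (∑ i, boolSign (v i) * a i) ^ 2).card : ℝ) ≤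
      (Finset.univ.filter p).card + (Finset.univ.filter p).card := by exact_mod_cast h2
  change _ ≤ ((Finset.univ.filter p).card : ℝ)
  linarith

section Vector

variable {E : Type*} [NormedAddCommGroup E] [NormedSpace ℝ E]

/-- A partial sum is the average of the full sum and of its image under reversal of the
remaining signs. -/
lemma two_smul_partial_sum {n : ℕ} (x : Fin n → E) (J : Finset (Fin n)) (v : Fin n → Bool) :
    (2 : ℝ) • ∑ i, boolSign (v i) • (if i ∈ J then x i else 0) =
      ∑ i, boolSign (v i) • x i + ∑ i, boolSign (flipOutside J v i) • x i := by
  rw [Finset.smul_sum, ← Finset.sum_add_distrib]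
  refine Finset.sum_congr rfl fun i _ => ?_
  rw [flipOutside_apply]
  split_ifs with h
  · rw [two_smul]
  · simp [boolSign_not]

lemma two_mul_norm_partial_sum_le {n : ℕ} (x : Fin n → E) (J : Finset (Fin n))
    (v : Fin n → Bool) :
    2 * ‖∑ i, boolSign (v i) • (if i ∈ J then x i else 0)‖ ≤
      ‖∑ i, boolSign (v i) • x i‖ + ‖∑ i, boolSign (flipOutside J v i) • x i‖ := by
  have h := norm_add_le (∑ i, boolSign (v i) • x i) (∑ i, boolSign (flipOutside J v i) • x i)
  rwa [← two_smul_partial_sum, norm_smul, Real.norm_ofNat] at h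

lemma sum_cube_norm_partial_le {n : ℕ} (x : Fin n → E) (J : Finset (Fin n)) :
    ∑ v : Fin n → Bool, ‖∑ i, boolSign (v i) • (if i ∈ J then x i else 0)‖ ≤
      ∑ v : Fin n → Bool, ‖∑ i, boolSign (v i) • x i‖ := by
  have h := Finset.sum_le_sum fun v (_ : v ∈ Finset.univ) => two_mul_norm_partial_sum_le x J v
  rw [Finset.sum_add_distrib, ← Finset.mul_sum,
    Equiv.sum_comp (flipOutside J) fun v => ‖∑ i, boolSign (v i) • x i‖] at h
  linarith

lemma card_cube_norm_partial_gt_le {n : ℕ} (x : Fin n → E) (J : Finset (Fin n)) (s : ℝ) :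
    (Finset.univ.filter fun v : Fin n → Bool =>
        s < ‖∑ i, boolSign (v i) • (if i ∈ J then x i else 0)‖).card ≤
      2 * (Finset.univ.filter fun v : Fin n → Bool => s < ‖∑ i, boolSign (v i) • x i‖).card := by
  let p : (Fin n → Bool) → Prop := fun v => s < ‖∑ i, boolSign (v i) • x i‖
  have hflip := card_cube_flipOutside J p
  rw [two_mul]
  nth_rw 2 [← hflip]
  refine (Finset.card_le_card fun v hv => ?_).trans (Finset.card_union_le _ _)
  simp only [Finset.mem_union, Finset.mem_filter, Finset.mem_univ, true_and, p] at hv ⊢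
  have := two_mul_norm_partial_sum_le x J v
  by_contra! h
  linarith [h.1, h.2]

lemma convex_norm_sum_smul_le {n : ℕ} (x : Fin n → E) (R : ℝ) :
    Convex ℝ {y : Fin n → ℝ | ‖∑ i, y i • x i‖ ≤ R} := by
  intro y hy z hz s t hs ht hst
  simp only [Set.mem_ofPred_eq] at *
  have : ∑ i, (s • y + t • z) i • x i = s • ∑ i, y i • x i + t • ∑ i, z i • x i := by
    rw [Finset.smul_sum, Finset.smul_sum, ← Finset.sum_add_distrib]
    refine Finset.sum_congr rfl fun i _ => ?_
    simp [add_smul, mul_smul]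
  rw [this]
  refine (norm_add_le _ _).trans ?_
  rw [norm_smul, norm_smul, Real.norm_of_nonneg hs, Real.norm_of_nonneg ht]
  calc _ ≤ s * R + t * R := by gcongr
    _ = R := by rw [← add_mul, hst, one_mul]

/-- Talagrand's inequality around a set `{‖∑ vᵢ xᵢ‖ ≤ R}` of probability at least `1/2`: each
point `v` of the cube is displaced by a vector `d v ∈ [-2, 2]ⁿ` so that the sum gets norm at
most `R`, and `exp (‖d‖² / 8)` has mean at most `2`. -/
lemma exists_displacement {n : ℕ} (x : Fin n → E) (R : ℝ)
    (hR : (2 : ℝ) ^ n ≤ 2 * (Finset.univ.filter fun v : Fin n → Bool =>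
      ‖∑ i, boolSign (v i) • x i‖ ≤ R).card) :
    ∃ d : (Fin n → Bool) → Fin n → ℝ, (∀ v i, |d v i| ≤ 2) ∧
      (∀ v, ‖∑ i, boolSign (v i) • x i‖ ≤ R + ‖∑ i, d v i • x i‖) ∧
      ∑ v, Real.exp ((∑ i, d v i ^ 2) / 8) ≤ 2 * 2 ^ n := by
  set A := Finset.univ.filter fun v : Fin n → Bool => ‖∑ i, boolSign (v i) • x i‖ ≤ R with hA
  have h2 : (0 : ℝ) < 2 ^ n := by positivity
  have hA0 : (0 : ℝ) < A.card := by linarith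
  obtain ⟨η, hη, hsum⟩ := exists_exp_sq_dist_convex_le n A
    (Finset.card_pos.1 (by exact_mod_cast hA0))
  refine ⟨fun v i => boolSign (v i) - η v i, fun v i => ?_, fun v => ?_, ?_⟩
  · have h1 := hη (Set.pi Set.univ fun _ => Set.Icc (-1 : ℝ) 1)
      (convex_pi fun _ _ => convex_Icc _ _)
      (fun w _ j _ => abs_le.1 (abs_boolSign (w j)).le) v i (Set.mem_univ i)
    refine (abs_sub _ _).trans ?_
    have := abs_le.2 h1
    rw [abs_boolSign]
    linarith
  · have h1 : ‖∑ i, η v i • x i‖ ≤ R := hη _ (convex_norm_sum_smul_le x R)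
      (fun w hw => by simpa [hA] using hw) v
    have h3 : ∑ i, boolSign (v i) • x i =
        ∑ i, η v i • x i + ∑ i, (boolSign (v i) - η v i) • x i := by
      rw [← Finset.sum_add_distrib]
      refine Finset.sum_congr rfl fun i _ => ?_
      rw [← add_smul, add_sub_cancel]
    rw [h3]
    exact (norm_add_le _ _).trans (by linarith)
  · have h3 : (0 : ℝ) ≤ ∑ v, Real.exp ((∑ i, (boolSign (v i) - η v i) ^ 2) / 8) :=
      Finset.sum_nonneg fun _ _ => (Real.exp_pos _).le
    have h4 := mul_le_mul_of_nonneg_left hR h3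
    have h5 : (4 : ℝ) ^ n = 2 ^ n * 2 ^ n := by rw [← mul_pow]; norm_num
    refine le_of_mul_le_mul_right (a := 2 ^ n) ?_ h2
    linarith

/-- Concentration of the norm when displacements with `‖d‖_∞ ≤ 2` and `‖d‖₂ ≤ t` change it by
at most `L`. -/
lemma card_cube_norm_gt_le {n : ℕ} (x : Fin n → E) {R L t : ℝ}
    (hR : (2 : ℝ) ^ n ≤ 2 * (Finset.univ.filter fun v : Fin n → Bool =>
      ‖∑ i, boolSign (v i) • x i‖ ≤ R).card)
    (hL : ∀ d : Fin n → ℝ, (∀ i, |d i| ≤ 2) → ∑ i, d i ^ 2 ≤ t ^ 2 → ‖∑ i, d i • x i‖ ≤ L) :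
    ((Finset.univ.filter fun v : Fin n → Bool =>
      R + L < ‖∑ i, boolSign (v i) • x i‖).card : ℝ) ≤ 2 * Real.exp (-t ^ 2 / 8) * 2 ^ n := by
  obtain ⟨d, hd, hdx, hsum⟩ := exists_displacement x R hR
  have h1 : ((Finset.univ.filter fun v : Fin n → Bool =>
      R + L < ‖∑ i, boolSign (v i) • x i‖).card : ℝ) * Real.exp (t ^ 2 / 8) ≤
      ∑ v, Real.exp ((∑ i, d v i ^ 2) / 8) := by
    rw [← nsmul_eq_mul, ← Finset.sum_const]
    refine (Finset.sum_le_sum fun v hv => ?_).trans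
      (Finset.sum_le_sum_of_subset_of_nonneg (Finset.filter_subset _ _)
        fun _ _ _ => (Real.exp_pos _).le)
    rw [Real.exp_le_exp]
    have hv := (Finset.mem_filter.1 hv).2
    by_contra! h
    have := hL (d v) (hd v) (by linarith)
    linarith [hdx v]
  rw [neg_div, Real.exp_neg]
  have h3 := Real.exp_pos (t ^ 2 / 8)
  have h4 : 2 * (Real.exp (t ^ 2 / 8))⁻¹ * 2 ^ n = (2 * 2 ^ n) / Real.exp (t ^ 2 / 8) := by
    field_simp
  rw [h4, le_div_iff₀ h3]
  exact h1.trans hsum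

lemma sum_cube_norm_sq_le {n : ℕ} (x : Fin n → E) {R σ : ℝ}
    (hR : (2 : ℝ) ^ n ≤ 2 * (Finset.univ.filter fun v : Fin n → Bool =>
      ‖∑ i, boolSign (v i) • x i‖ ≤ R).card) (hσ : 0 ≤ σ)
    (h : ∀ d : Fin n → ℝ, ‖∑ i, d i • x i‖ ^ 2 ≤ σ * ∑ i, d i ^ 2) :
    ∑ v : Fin n → Bool, ‖∑ i, boolSign (v i) • x i‖ ^ 2 ≤ (2 * R ^ 2 + 32 * σ) * 2 ^ n := by
  obtain ⟨d, -, hdx, hsum⟩ := exists_displacement x R hR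
  have key : ∀ v : Fin n → Bool, ‖∑ i, boolSign (v i) • x i‖ ^ 2 ≤
      2 * R ^ 2 + 16 * σ * Real.exp ((∑ i, d v i ^ 2) / 8) := by
    intro v
    have h1 := pow_le_pow_left₀ (norm_nonneg _) (hdx v) 2
    have h2 := h (d v)
    -- `y ≤ exp y` at `y = ‖d v‖² / 8`
    have h3 := mul_le_mul_of_nonneg_left (Real.add_one_le_exp ((∑ i, d v i ^ 2) / 8)) hσ
    have h4 := sq_nonneg (R - ‖∑ i, d v i • x i‖)
    nlinarith
  refine (Finset.sum_le_sum fun v _ => key v).trans ?_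
  have := mul_le_mul_of_nonneg_left hsum (by positivity : 0 ≤ 16 * σ)
  simp only [Finset.sum_add_distrib, Finset.sum_const, Finset.card_univ, Fintype.card_pi,
    Fintype.card_bool, Finset.prod_const, Fintype.card_fin, nsmul_eq_mul, Nat.cast_pow,
    Nat.cast_ofNat]
  rw [← Finset.mul_sum]
  linarith

end Vector

/-! ### Rademacher sequences and the uniform measure on the cube -/

section Transfer

variable {Ω : Type*} [MeasurableSpace Ω] {P : Measure Ω} {ε : ℕ → Ω → ℝ}

/-- The Boolean code of the first `N` signs. -/
noncomputable def signCode (ε : ℕ → Ω → ℝ) (N : ℕ) (ω : Ω) : Fin N → Bool :=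
  fun i => decide (ε i ω = 1)

lemma IsRademacherSequence.measurable_signCode (hε : IsRademacherSequence P ε) (N : ℕ) :
    Measurable (signCode ε N) := by
  refine measurable_pi_lambda _ fun i => ?_
  refine measurable_to_bool ?_
  have : (fun ω => signCode ε N ω i) ⁻¹' {true} = {ω | ε i ω = 1} := by
    ext ω; simp [signCode]
  rw [this]
  exact hε.measurable i (measurableSet_singleton 1)

variable [IsProbabilityMeasure P]

lemma IsRademacherSequence.ae_eq_one_or (hε : IsRademacherSequence P ε) (n : ℕ) :
    ∀ᵐ ω ∂P, ε n ω = 1 ∨ ε n ω = -1 := by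
  have hd : Disjoint {ω | ε n ω = 1} {ω | ε n ω = -1} := by
    rw [Set.disjoint_left]
    intro ω h1 h2
    simp only [Set.mem_ofPred_eq] at h1 h2
    linarith
  have hm1 : MeasurableSet {ω | ε n ω = 1} := hε.measurable n (measurableSet_singleton 1)
  have hm2 : MeasurableSet {ω | ε n ω = -1} := hε.measurable n (measurableSet_singleton (-1))
  have h : P ({ω | ε n ω = 1} ∪ {ω | ε n ω = -1}) = 1 := by
    rw [measure_union hd hm2, hε.prob_one, hε.prob_neg_one, ENNReal.add_halves]
  exact (prob_compl_eq_zero_iff (hm1.union hm2)).2 h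

lemma IsRademacherSequence.ae_boolSign_signCode (hε : IsRademacherSequence P ε) (N : ℕ) :
    ∀ᵐ ω ∂P, (fun i : Fin N => ε i ω) = fun i => boolSign (signCode ε N ω i) := by
  have h : ∀ᵐ ω ∂P, ∀ n, ε n ω = 1 ∨ ε n ω = -1 := ae_all_iff.2 hε.ae_eq_one_or
  filter_upwards [h] with ω hω
  ext i
  rcases hω i with h | h <;> norm_num [boolSign, signCode, h]

/-- The first `N` signs are uniformly distributed on the cube. -/
lemma IsRademacherSequence.map_signCode (hε : IsRademacherSequence P ε) (N : ℕ)
    (v : Fin N → Bool) : (P.map (signCode ε N)).real {v} = 1 / 2 ^ N := by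
  rw [map_measureReal_apply (hε.measurable_signCode N) (measurableSet_singleton v)]
  -- independence is indexed by `ℕ`, so the prescribed values are extended by the trivial event
  let B : ℕ → Set ℝ := fun n => if h : n < N then {boolSign (v ⟨n, h⟩)} else Set.univ
  have hae : signCode ε N ⁻¹' {v} =ᵐ[P] ⋂ n ∈ Finset.range N, ε n ⁻¹' B n := by
    refine Filter.eventuallyEq_set.2 ?_
    filter_upwards [hε.ae_boolSign_signCode N] with ω hω
    simp only [Set.mem_iInter, Finset.mem_range, Set.mem_preimage, Set.mem_singleton_iff]
    constructor
    · rintro rfl n hn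
      have := congrFun hω ⟨n, hn⟩
      simpa [B, hn] using this
    · intro h
      ext i
      have h1 := h i i.2
      have h2 := congrFun hω i
      simp only [Fin.is_lt, B, dite_true, Set.mem_singleton_iff, Fin.eta] at h1
      rw [h1] at h2
      revert h2
      cases v i <;> cases signCode ε N ω i <;> norm_num [boolSign]
  rw [measureReal_congr hae, measureReal_def,
    hε.indep.measure_inter_preimage_eq_mul (Finset.range N)
    (fun n hn => by simp only [Finset.mem_range] at hn; simp [B, hn])]
  have hB : ∀ n ∈ Finset.range N, P (ε n ⁻¹' B n) = 1 / 2 := by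
    intro n hn
    simp only [Finset.mem_range] at hn
    simp only [B, hn, dite_true]
    cases v ⟨n, hn⟩
    · exact hε.prob_neg_one n
    · exact hε.prob_one n
  rw [Finset.prod_congr rfl hB]
  simp

lemma IsRademacherSequence.measureReal_eq_card (hε : IsRademacherSequence P ε) (N : ℕ)
    (p : (Fin N → ℝ) → Prop) [DecidablePred fun v : Fin N → Bool => p fun i => boolSign (v i)] :
    P.real {ω | p fun i => ε i ω} =
      (Finset.univ.filter fun v : Fin N → Bool => p fun i => boolSign (v i)).card / 2 ^ N := by
  have hae : ({ω | p fun i => ε i ω} : Set Ω) =ᵐ[P]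
      signCode ε N ⁻¹' (Finset.univ.filter fun v : Fin N → Bool => p fun i => boolSign (v i)) := by
    refine Filter.eventuallyEq_set.2 ?_
    filter_upwards [hε.ae_boolSign_signCode N] with ω hω
    simp [hω]
  rw [measureReal_congr hae, ← map_measureReal_apply (hε.measurable_signCode N)
    (Finset.measurableSet _), ← sum_measureReal_singleton]
  simp [hε.map_signCode, div_eq_mul_inv]

lemma IsRademacherSequence.integrable_comp (hε : IsRademacherSequence P ε) (N : ℕ)
    (F : (Fin N → ℝ) → ℝ) : Integrable (fun ω => F fun i => ε i ω) P := by
  have h : (fun ω => F fun i => ε i ω) =ᵐ[P]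
      (fun v : Fin N → Bool => F fun i => boolSign (v i)) ∘ signCode ε N := by
    filter_upwards [hε.ae_boolSign_signCode N] with ω hω
    rw [hω]; rfl
  have : IsFiniteMeasure (P.map (signCode ε N)) := inferInstance
  exact ((Integrable.of_finite).comp_measurable (hε.measurable_signCode N)).congr h.symm

lemma IsRademacherSequence.integral_comp (hε : IsRademacherSequence P ε) (N : ℕ)
    (F : (Fin N → ℝ) → ℝ) :
    ∫ ω, F (fun i => ε i ω) ∂P = (∑ v : Fin N → Bool, F fun i => boolSign (v i)) / 2 ^ N := by
  have h : (fun ω => F fun i => ε i ω) =ᵐ[P]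
      fun ω => (fun v : Fin N → Bool => F fun i => boolSign (v i)) (signCode ε N ω) := by
    filter_upwards [hε.ae_boolSign_signCode N] with ω hω
    rw [hω]
  rw [integral_congr_ae h, ← integral_map (f := fun v : Fin N → Bool => F fun i => boolSign (v i))
    (hε.measurable_signCode N).aemeasurable
      (measurable_of_finite _).aestronglyMeasurable, integral_fintype Integrable.of_finite]
  simp [hε.map_signCode, Finset.mul_sum, div_eq_inv_mul]

end Transfer

section PartialSums

variable {E : Type*} [NormedAddCommGroup E] [NormedSpace ℝ E]
  {Ω : Type*} [MeasurableSpace Ω] {P : Measure Ω} [IsProbabilityMeasure P]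
  {ε : ℕ → Ω → ℝ}

lemma IsRademacherSequence.integrable_norm (hε : IsRademacherSequence P ε) (x : ℕ → E) (N : ℕ) :
    Integrable (fun ω => ‖∑ n ∈ Finset.range N, ε n ω • x n‖) P := by
  simp only [Finset.sum_range]
  exact hε.integrable_comp N fun y => ‖∑ i : Fin N, y i • x i‖

lemma IsRademacherSequence.integrable_norm_sq (hε : IsRademacherSequence P ε) (x : ℕ → E)
    (N : ℕ) : Integrable (fun ω => ‖∑ n ∈ Finset.range N, ε n ω • x n‖ ^ 2) P := by
  simp only [Finset.sum_range]
  exact hε.integrable_comp N fun y => ‖∑ i : Fin N, y i • x i‖ ^ 2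

lemma sum_range_smul_eq_ite {N M : ℕ} (h : N ≤ M) (s : ℕ → ℝ) (x : ℕ → E) :
    ∑ n ∈ Finset.range N, s n • x n =
      ∑ i : Fin M, s i • (if i ∈ Finset.univ.filter (fun i : Fin M => (i : ℕ) < N) then x i
        else 0) := by
  have h1 := Finset.sum_range (n := M) fun n => s n • (if n < N then x n else 0)
  simp only [Finset.mem_filter, Finset.mem_univ, true_and]
  rw [← h1]
  simp only [smul_ite, smul_zero]
  rw [← Finset.sum_filter]
  congr 1
  ext n
  simp only [Finset.mem_range, Finset.mem_filter]
  omega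

lemma IsRademacherSequence.integral_norm_mono (hε : IsRademacherSequence P ε) (x : ℕ → E) :
    Monotone fun N => ∫ ω, ‖∑ n ∈ Finset.range N, ε n ω • x n‖ ∂P := by
  intro N M h
  simp only
  set J := Finset.univ.filter (fun i : Fin M => (i : ℕ) < N) with hJ
  have h1 : ∀ ω, ‖∑ n ∈ Finset.range N, ε n ω • x n‖ =
      ‖∑ i : Fin M, ε i ω • (if i ∈ J then x i else 0)‖ := fun ω => by
    rw [sum_range_smul_eq_ite h (fun n => ε n ω)]
  simp only [h1]
  simp only [Finset.sum_range]
  rw [hε.integral_comp M fun y => ‖∑ i : Fin M, y i • (if i ∈ J then x i else 0)‖,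
    hε.integral_comp M fun y => ‖∑ i : Fin M, y i • x i‖]
  gcongr ?_ / _
  exact sum_cube_norm_partial_le (fun i : Fin M => x i) J

/-- Lévy-type inequality: a partial sum has tails at most twice those of a longer one. -/
lemma IsRademacherSequence.measureReal_norm_gt_le (hε : IsRademacherSequence P ε) (x : ℕ → E)
    {N M : ℕ} (h : N ≤ M) (s : ℝ) :
    P.real {ω | s < ‖∑ n ∈ Finset.range N, ε n ω • x n‖} ≤
      2 * P.real {ω | s < ‖∑ n ∈ Finset.range M, ε n ω • x n‖} := by
  classical
  set J := Finset.univ.filter (fun i : Fin M => (i : ℕ) < N) with hJ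
  have h1 : ∀ ω, ‖∑ n ∈ Finset.range N, ε n ω • x n‖ =
      ‖∑ i : Fin M, ε i ω • (if i ∈ J then x i else 0)‖ := fun ω => by
    rw [sum_range_smul_eq_ite h (fun n => ε n ω)]
  simp only [h1]
  simp only [Finset.sum_range]
  rw [hε.measureReal_eq_card M fun y => s < ‖∑ i : Fin M, y i • (if i ∈ J then x i else 0)‖,
    hε.measureReal_eq_card M fun y => s < ‖∑ i : Fin M, y i • x i‖, ← mul_div_assoc]
  gcongr
  exact_mod_cast card_cube_norm_partial_gt_le (fun i : Fin M => x i) J s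

lemma IsRademacherSequence.measureReal_sq_ge (hε : IsRademacherSequence P ε) (a : ℕ → ℝ)
    (N : ℕ) : 3 / 16 ≤ P.real {ω | (∑ n ∈ Finset.range N, a n ^ 2) / 4 ≤
      (∑ n ∈ Finset.range N, ε n ω * a n) ^ 2} := by
  simp only [Finset.sum_range]
  rw [hε.measureReal_eq_card N fun y => (∑ i : Fin N, a i ^ 2) / 4 ≤
    (∑ i : Fin N, y i * a i) ^ 2, le_div_iff₀ (by positivity)]
  exact card_cube_sq_ge N fun i => a i

/-- A scalar Rademacher sum exceeds half its standard deviation with probability at least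
`3 / 32`. -/
lemma IsRademacherSequence.measureReal_ge (hε : IsRademacherSequence P ε) (a : ℕ → ℝ)
    (S : Finset ℕ) :
    3 / 32 ≤ P.real {ω | √(∑ n ∈ S, a n ^ 2) / 2 ≤ ∑ n ∈ S, ε n ω * a n} := by
  obtain ⟨N, hN⟩ := S.exists_nat_subset_range
  have h1 : ∀ g : ℕ → ℝ, ∑ n ∈ S, g n = ∑ n ∈ Finset.range N, if n ∈ S then g n else 0 := by
    intro g
    rw [← Finset.sum_filter, Finset.filter_mem_eq_inter, Finset.inter_eq_right.2 hN]
  let b : ℕ → ℝ := fun n => if n ∈ S then a n else 0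
  have h2 : ∑ n ∈ S, a n ^ 2 = ∑ i : Fin N, b i ^ 2 := by
    rw [h1, Finset.sum_range]
    simp [b]
  have h3 : ∀ ω, ∑ n ∈ S, ε n ω * a n = ∑ i : Fin N, ε i ω * b i := by
    intro ω
    rw [h1, Finset.sum_range]
    simp [b]
  simp only [h2, h3]
  rw [hε.measureReal_eq_card N fun y => √(∑ i : Fin N, b i ^ 2) / 2 ≤
    ∑ i : Fin N, y i * b i, le_div_iff₀ (by positivity)]
  exact card_cube_ge N fun i => b i

lemma IsRademacherSequence.measureReal_norm_gt_le_exp (hε : IsRademacherSequence P ε)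
    (x : ℕ → E) (N : ℕ) {R L t : ℝ}
    (hR : 1 / 2 ≤ P.real {ω | ‖∑ n ∈ Finset.range N, ε n ω • x n‖ ≤ R})
    (hL : ∀ d : ℕ → ℝ, (∀ i < N, |d i| ≤ 2) → ∑ i ∈ Finset.range N, d i ^ 2 ≤ t ^ 2 →
      ‖∑ i ∈ Finset.range N, d i • x i‖ ≤ L) :
    P.real {ω | R + L < ‖∑ n ∈ Finset.range N, ε n ω • x n‖} ≤ 2 * Real.exp (-t ^ 2 / 8) := by
  classical
  simp only [Finset.sum_range] at hR ⊢
  rw [hε.measureReal_eq_card N fun y => ‖∑ i : Fin N, y i • x i‖ ≤ R,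
    le_div_iff₀ (by positivity)] at hR
  rw [hε.measureReal_eq_card N fun y => R + L < ‖∑ i : Fin N, y i • x i‖,
    div_le_iff₀ (by positivity)]
  refine card_cube_norm_gt_le (fun i : Fin N => x i) (by linarith) fun d hd hdt => ?_
  have h := hL (fun n => if h : n < N then d ⟨n, h⟩ else 0)
    (fun i hi => by simp only [hi, dite_true]; exact hd _)
    (by rw [Finset.sum_range]; simpa using hdt)
  rw [Finset.sum_range] at h
  simpa using h

/-- If `‖S_N‖` were often smaller than `R` while `∑ f (x n)² > 4 R²`, the scalar
Paley–Zygmund inequality for `f (S_N)` would be violated. -/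
lemma IsRademacherSequence.sum_sq_le_of_measureReal_lt (hε : IsRademacherSequence P ε)
    (x : ℕ → E) (N : ℕ) {R : ℝ}
    (hR : P.real {ω | R < ‖∑ n ∈ Finset.range N, ε n ω • x n‖} < 3 / 16)
    (f : StrongDual ℝ E) (hf : ‖f‖ ≤ 1) : ∑ n ∈ Finset.range N, f (x n) ^ 2 ≤ 4 * R ^ 2 := by
  by_contra! h
  refine absurd ((hε.measureReal_sq_ge (fun n => f (x n)) N).trans
    (measureReal_mono fun ω hω => ?_)) hR.not_ge
  simp only [Set.mem_ofPred_eq] at hω ⊢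
  have h1 : ∑ n ∈ Finset.range N, ε n ω * f (x n) = f (∑ n ∈ Finset.range N, ε n ω • x n) := by
    simp
  rw [h1] at hω
  have h2 : |f (∑ n ∈ Finset.range N, ε n ω • x n)| ≤ ‖∑ n ∈ Finset.range N, ε n ω • x n‖ := by
    simpa using f.le_of_opNorm_le hf (∑ n ∈ Finset.range N, ε n ω • x n)
  refine lt_of_lt_of_le ?_ h2
  refine abs_lt_of_sq_lt_sq' ?_ (abs_nonneg _) |>.2
  rw [sq_abs]
  linarith

/-- A quantile of the norm controls its second moment: it controls the weak variance, and then
Talagrand's inequality applies. -/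
lemma IsRademacherSequence.integral_norm_sq_le_of_measureReal_lt (hε : IsRademacherSequence P ε)
    (x : ℕ → E) (N : ℕ) {R : ℝ}
    (hR : P.real {ω | R < ‖∑ n ∈ Finset.range N, ε n ω • x n‖} < 3 / 16) :
    ∫ ω, ‖∑ n ∈ Finset.range N, ε n ω • x n‖ ^ 2 ∂P ≤ 130 * R ^ 2 := by
  classical
  have hσ : ∀ d : ℕ → ℝ, ‖∑ n ∈ Finset.range N, d n • x n‖ ^ 2 ≤
      4 * R ^ 2 * ∑ n ∈ Finset.range N, d n ^ 2 := by
    intro d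
    obtain ⟨f, hf, hfv⟩ := exists_dual_vector'' ℝ (∑ n ∈ Finset.range N, d n • x n)
    have h1 : f (∑ n ∈ Finset.range N, d n • x n) = ∑ n ∈ Finset.range N, d n * f (x n) := by
      simp
    have h2 : ‖∑ n ∈ Finset.range N, d n • x n‖ = ∑ n ∈ Finset.range N, d n * f (x n) := by
      rw [← h1, hfv]; rfl
    rw [h2]
    refine (Finset.sum_mul_sq_le_sq_mul_sq _ _ _).trans ?_
    rw [mul_comm]
    gcongr
    exact hε.sum_sq_le_of_measureReal_lt x N hR f hf
  have hR' : 1 / 2 ≤ P.real {ω | ‖∑ n ∈ Finset.range N, ε n ω • x n‖ ≤ R} := by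
    have h1 : (1 : ℝ) ≤ P.real {ω | ‖∑ n ∈ Finset.range N, ε n ω • x n‖ ≤ R} +
        P.real {ω | R < ‖∑ n ∈ Finset.range N, ε n ω • x n‖} := by
      rw [← probReal_univ (μ := P)]
      refine (measureReal_mono fun ω _ => ?_).trans (measureReal_union_le _ _)
      exact le_or_gt ‖∑ n ∈ Finset.range N, ε n ω • x n‖ R
    linarith
  simp only [Finset.sum_range] at hR' ⊢
  rw [hε.measureReal_eq_card N fun y => ‖∑ i : Fin N, y i • x i‖ ≤ R,
    le_div_iff₀ (by positivity)] at hR'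
  rw [hε.integral_comp N fun y => ‖∑ i : Fin N, y i • x i‖ ^ 2, div_le_iff₀ (by positivity)]
  have h := sum_cube_norm_sq_le (fun i : Fin N => x i) (R := R) (σ := 4 * R ^ 2) (by linarith)
    (by positivity) fun d => by
      have := hσ (fun n => if h : n < N then d ⟨n, h⟩ else 0)
      rw [Finset.sum_range, Finset.sum_range] at this
      simpa using this
  linarith

end PartialSums

/-! ### Lower tails of scalar Rademacher sums -/

/-- Weights that are individually at most `δ` and sum to at least `δ` contain a block of weight
between `δ` and `2 δ`. -/
lemma exists_subset_sum_mem_Icc (w : ℕ → ℝ) {δ : ℝ} (hδ : 0 ≤ δ) (S : Finset ℕ)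
    (hw : ∀ n ∈ S, w n ≤ δ) (hS : δ ≤ ∑ n ∈ S, w n) :
    ∃ B ⊆ S, δ ≤ ∑ n ∈ B, w n ∧ ∑ n ∈ B, w n ≤ 2 * δ := by
  induction S using Finset.induction_on with
  | empty => exact ⟨∅, subset_rfl, hS, by simpa using hδ⟩
  | insert k S hk ih =>
    by_cases h : δ ≤ ∑ n ∈ S, w n
    · obtain ⟨B, hB, h1, h2⟩ := ih (fun n hn => hw n (Finset.mem_insert_of_mem hn)) h
      exact ⟨B, hB.trans (Finset.subset_insert _ _), h1, h2⟩
    · refine ⟨insert k S, subset_rfl, hS, ?_⟩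
      rw [Finset.sum_insert hk]
      linarith [hw k (Finset.mem_insert_self _ _)]

section Blocks

variable {Ω : Type*} [MeasurableSpace Ω] {P : Measure Ω} [IsProbabilityMeasure P]
  {ε : ℕ → Ω → ℝ}

/-- Independence of Rademacher sums over disjoint sets of indices. -/
lemma IsRademacherSequence.measureReal_mul_le (hε : IsRademacherSequence P ε) (a : ℕ → ℝ)
    {S T : Finset ℕ} (h : Disjoint S T) (r s : ℝ) :
    P.real {ω | r ≤ ∑ n ∈ S, ε n ω * a n} * P.real {ω | s ≤ ∑ n ∈ T, ε n ω * a n} ≤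
      P.real {ω | r + s ≤ ∑ n ∈ S ∪ T, ε n ω * a n} := by
  have hind := hε.indep.indepFun_finset S T h hε.measurable
  have hmeas : ∀ S : Finset ℕ, Measurable fun y : S → ℝ => ∑ n : S, y n * a n := by
    intro S; fun_prop
  have hind2 := hind.comp (hmeas S) (hmeas T)
  have hset : ∀ (S : Finset ℕ) (r : ℝ), {ω | r ≤ ∑ n ∈ S, ε n ω * a n} =
      ((fun y : S → ℝ => ∑ n : S, y n * a n) ∘ fun ω (i : S) => ε i ω) ⁻¹' Set.Ici r := by
    intro S r
    ext ω
    simp only [Set.mem_ofPred_eq, Set.mem_preimage, Function.comp_apply, Set.mem_Ici]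
    rw [Finset.sum_coe_sort S fun n => ε n ω * a n]
  have hmul := hind2.measure_inter_preimage_eq_mul (Set.Ici r) (Set.Ici s) measurableSet_Ici
    measurableSet_Ici
  rw [← hset, ← hset] at hmul
  rw [measureReal_def, measureReal_def, ← ENNReal.toReal_mul, ← hmul, ← measureReal_def]
  refine measureReal_mono fun ω hω => ?_
  simp only [Set.mem_inter_iff, Set.mem_ofPred_eq] at hω ⊢
  rw [Finset.sum_union h]
  linarith [hω.1, hω.2]

/-- If all squares `a n ^ 2` are at most `δ` and sum to at least `2 k δ`, then the sum splits
into `k` independent blocks of standard deviation at least `√δ` (and a remainder). -/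
lemma IsRademacherSequence.pow_le_measureReal_of_sq_le (hε : IsRademacherSequence P ε)
    (a : ℕ → ℝ) {δ : ℝ} (hδ : 0 ≤ δ) (k : ℕ) (S : Finset ℕ) (hS : ∀ n ∈ S, a n ^ 2 ≤ δ)
    (h : 2 * k * δ ≤ ∑ n ∈ S, a n ^ 2) :
    (3 / 32 : ℝ) ^ (k + 1) ≤ P.real {ω | k * (√δ / 2) ≤ ∑ n ∈ S, ε n ω * a n} := by
  induction k generalizing S with
  | zero =>
    rw [zero_add, pow_one]
    refine (hε.measureReal_ge a S).trans (measureReal_mono fun ω hω => ?_)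
    simp only [Set.mem_ofPred_eq, Nat.cast_zero, zero_mul] at hω ⊢
    exact (by positivity : (0 : ℝ) ≤ √(∑ n ∈ S, a n ^ 2) / 2).trans hω
  | succ k ih =>
    push_cast at h
    have hk : (0 : ℝ) ≤ k * δ := by positivity
    obtain ⟨B, hBS, h1, h2⟩ := exists_subset_sum_mem_Icc (fun n => a n ^ 2) hδ S hS (by linarith)
    have h3 := Finset.sum_sdiff (f := fun n => a n ^ 2) hBS
    have h4 := ih (S \ B) (fun n hn => hS n (Finset.mem_sdiff.1 hn).1) (by linarith)
    have h5 := hε.measureReal_mul_le a (S := S \ B) (T := B) Finset.sdiff_disjoint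
      (k * (√δ / 2)) (√(∑ n ∈ B, a n ^ 2) / 2)
    rw [Finset.sdiff_union_of_subset hBS] at h5
    rw [pow_succ]
    refine (mul_le_mul h4 (hε.measureReal_ge a B) (by norm_num) measureReal_nonneg).trans
      (h5.trans (measureReal_mono fun ω hω => ?_))
    simp only [Set.mem_ofPred_eq] at hω ⊢
    have h6 := Real.sqrt_le_sqrt h1
    push_cast
    linarith

/-- Lower tail estimate for scalar sums. Up to a constant, the level `r` dominates
`‖b‖₁ + √m ‖c‖₂` for a suitable decomposition `a = b + c` on `S`, with `b` supported by `T`. -/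
lemma IsRademacherSequence.exists_pow_le_measureReal (hε : IsRademacherSequence P ε)
    (a : ℕ → ℝ) (m : ℕ) (S : Finset ℕ) :
    ∃ T ⊆ S, ∃ r, (3 / 32 : ℝ) ^ (m + 1) ≤ P.real {ω | r ≤ ∑ n ∈ S, ε n ω * a n} ∧
      ∑ n ∈ T, |a n| + √m * √(∑ n ∈ S \ T, a n ^ 2) ≤ 6 * r := by
  induction m generalizing S with
  | zero =>
    refine ⟨∅, Finset.empty_subset _, 0, ?_, by simp⟩
    simpa using hε.pow_le_measureReal_of_sq_le a
      (Finset.sum_nonneg fun n (_ : n ∈ S) => sq_nonneg (a n)) 0 S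
      (fun n hn => Finset.single_le_sum (f := fun n => a n ^ 2) (fun n _ => sq_nonneg (a n)) hn)
      (by simpa using Finset.sum_nonneg fun n (_ : n ∈ S) => sq_nonneg (a n))
  | succ m ih =>
    set s := ∑ n ∈ S, a n ^ 2 with hs
    have hs0 : 0 ≤ s := Finset.sum_nonneg fun n _ => sq_nonneg _
    have hm : (0 : ℝ) < m + 1 := by positivity
    by_cases h : ∃ k ∈ S, s / (2 * (m + 1)) ≤ a k ^ 2
    -- a single large coefficient forms a block of its own
    · obtain ⟨k, hk, hak⟩ := h
      obtain ⟨T, hT, r, hr, hle⟩ := ih (S.erase k)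
      have hkT : k ∉ T := fun h => Finset.notMem_erase k S (hT h)
      refine ⟨insert k T, Finset.insert_subset hk (hT.trans (Finset.erase_subset _ _)),
        r + |a k| / 2, ?_, ?_⟩
      · have h1 := hε.measureReal_mul_le a (S := S.erase k) (T := {k})
          (Finset.disjoint_singleton_right.2 (Finset.notMem_erase k S)) r (|a k| / 2)
        rw [Finset.union_comm, ← Finset.insert_eq, Finset.insert_erase hk] at h1
        have h2 := hε.measureReal_ge a {k}
        rw [Finset.sum_singleton, Real.sqrt_sq_eq_abs] at h2
        rw [pow_succ]
        exact (mul_le_mul hr h2 (by norm_num) measureReal_nonneg).trans h1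
      · have hsd : S \ insert k T = S.erase k \ T := by
          ext n; simp only [Finset.mem_sdiff, Finset.mem_insert, Finset.mem_erase]; tauto
        rw [Finset.sum_insert hkT, hsd]
        set c := ∑ n ∈ S.erase k \ T, a n ^ 2 with hc
        have hcs : c ≤ s := Finset.sum_le_sum_of_subset_of_nonneg
          (Finset.sdiff_subset.trans (Finset.erase_subset _ _)) fun _ _ _ => sq_nonneg _
        rw [div_le_iff₀ (by positivity)] at hak
        -- raising `m` by one costs `(√(m + 1) - √m) √c ≤ 2 |a k|`, as `c ≤ 2 (m + 1) (a k)²`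
        have h3 : √c ≤ √(m + 1) * (2 * |a k|) := by
          rw [Real.sqrt_le_left (by positivity), mul_pow, Real.sq_sqrt hm.le, mul_pow, sq_abs]
          nlinarith [sq_nonneg (a k)]
        have h4 : √(m : ℝ) ≤ √((m : ℝ) + 1) := Real.sqrt_le_sqrt (by linarith)
        have h5 : (√((m : ℝ) + 1) - √(m : ℝ)) * √((m : ℝ) + 1) ≤ 1 := by
          have h6 := Real.mul_self_sqrt hm.le
          have h7 := Real.mul_self_sqrt (Nat.cast_nonneg (α := ℝ) m)
          have h8 := mul_le_mul_of_nonneg_left h4 (Real.sqrt_nonneg (m : ℝ))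
          linarith
        have h9 : (√((m : ℝ) + 1) - √(m : ℝ)) * √c ≤ 2 * |a k| := by
          calc _ ≤ (√((m : ℝ) + 1) - √(m : ℝ)) * (√(m + 1) * (2 * |a k|)) :=
                mul_le_mul_of_nonneg_left h3 (sub_nonneg.2 h4)
            _ = ((√((m : ℝ) + 1) - √(m : ℝ)) * √((m : ℝ) + 1)) * (2 * |a k|) := by ring
            _ ≤ 1 * (2 * |a k|) := by gcongr
            _ = 2 * |a k| := one_mul _
        push_cast
        linarith
    -- otherwise all coefficients are small and `S` splits into `m + 1` blocks
    · push Not at h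
      set δ := s / (2 * (m + 1)) with hδ
      have hδ0 : 0 ≤ δ := by positivity
      have hsδ : s = 2 * (m + 1) * δ := by rw [hδ]; field_simp
      refine ⟨∅, Finset.empty_subset _, _, hε.pow_le_measureReal_of_sq_le a hδ0 (m + 1) S
        (fun n hn => (h n hn).le) (by push_cast; exact hsδ.ge), ?_⟩
      rw [Finset.sum_empty, Finset.sdiff_empty, ← hs, zero_add]
      push_cast
      have h1 : √s ≤ √((m : ℝ) + 1) * (2 * √δ) := by
        rw [Real.sqrt_le_left (by positivity), mul_pow, Real.sq_sqrt hm.le, mul_pow,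
          Real.sq_sqrt hδ0]
        nlinarith [mul_nonneg hm.le hδ0]
      have h2 := mul_le_mul_of_nonneg_left h1 (Real.sqrt_nonneg ((m : ℝ) + 1))
      rw [← mul_assoc, Real.mul_self_sqrt hm.le] at h2
      have := mul_nonneg hm.le (Real.sqrt_nonneg δ)
      linarith

end Blocks

/-! ### Almost sure limits of random variables bounded in mean square -/

section Limits

variable {Ω : Type*} [MeasurableSpace Ω] {P : Measure Ω} {Z : ℕ → Ω → ℝ} {Y : Ω → ℝ}

lemma integrable_sq_of_tendsto (hZm : ∀ N, Measurable (Z N))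
    (hZ2 : ∀ N, Integrable (fun ω => Z N ω ^ 2) P)
    (hlim : ∀ᵐ ω ∂P, Tendsto (fun N => Z N ω) atTop (𝓝 (Y ω)))
    {C : ℝ} (h : ∀ N, ∫ ω, Z N ω ^ 2 ∂P ≤ C) :
    Integrable (fun ω => Y ω ^ 2) P ∧ ∫ ω, Y ω ^ 2 ∂P ≤ C := by
  have hC : 0 ≤ C := (integral_nonneg fun ω => sq_nonneg _).trans (h 0)
  have hYm : AEStronglyMeasurable Y P :=
    aestronglyMeasurable_of_tendsto_ae atTop (fun N => (hZm N).aestronglyMeasurable) hlim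
  have hY2 : AEStronglyMeasurable (fun ω => Y ω ^ 2) P := hYm.pow 2
  have key : ∫⁻ ω, ENNReal.ofReal (Y ω ^ 2) ∂P ≤ ENNReal.ofReal C := by
    calc ∫⁻ ω, ENNReal.ofReal (Y ω ^ 2) ∂P
        = ∫⁻ ω, liminf (fun N => ENNReal.ofReal (Z N ω ^ 2)) atTop ∂P := by
          refine lintegral_congr_ae ?_
          filter_upwards [hlim] with ω hω
          exact ((ENNReal.tendsto_ofReal (hω.pow 2)).liminf_eq).symm
      _ ≤ liminf (fun N => ∫⁻ ω, ENNReal.ofReal (Z N ω ^ 2) ∂P) atTop :=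
          lintegral_liminf_le fun N => ((hZm N).pow_const 2).ennreal_ofReal
      _ ≤ ENNReal.ofReal C := by
          refine liminf_le_of_le (by isBoundedDefault) fun b hb => ?_
          obtain ⟨N, hN⟩ := hb.exists
          refine hN.trans ?_
          rw [← ofReal_integral_eq_lintegral_ofReal (hZ2 N) (ae_of_all _ fun ω => sq_nonneg _)]
          exact ENNReal.ofReal_le_ofReal (h N)
  have hint : Integrable (fun ω => Y ω ^ 2) P := by
    refine ⟨hY2, ?_⟩
    rw [hasFiniteIntegral_iff_ofReal (ae_of_all _ fun ω => sq_nonneg _)]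
    exact key.trans_lt ENNReal.ofReal_lt_top
  refine ⟨hint, ?_⟩
  rw [integral_eq_lintegral_of_nonneg_ae (ae_of_all _ fun ω => sq_nonneg _) hY2]
  exact ENNReal.toReal_le_of_le_ofReal hC key

variable [IsProbabilityMeasure P]

lemma measureReal_gt_le_of_tendsto (hlim : ∀ᵐ ω ∂P, Tendsto (fun N => Z N ω) atTop (𝓝 (Y ω)))
    {s p : ℝ} (h : ∀ N, P.real {ω | s < Z N ω} ≤ p) : P.real {ω | s < Y ω} ≤ p := by
  have hp : 0 ≤ p := measureReal_nonneg.trans (h 0)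
  let D : ℕ → Set Ω := fun N => ⋂ M ≥ N, {ω | s < Z M ω}
  have hD : Monotone D := fun N N' hN => Set.biInter_subset_biInter_left fun M hM => hN.trans hM
  have h1 : P {ω | s < Y ω} ≤ P (⋃ N, D N) := by
    refine measure_mono_ae ?_
    filter_upwards [hlim] with ω hω hs
    obtain ⟨N, hN⟩ := eventually_atTop.1 (hω.eventually (lt_mem_nhds hs))
    exact Set.mem_iUnion.2 ⟨N, Set.mem_iInter₂.2 fun M hM => hN M hM⟩
  have h2 : P (⋃ N, D N) ≤ ENNReal.ofReal p := by
    rw [hD.measure_iUnion]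
    refine iSup_le fun N => ?_
    refine (measure_mono (Set.iInter₂_subset N le_rfl)).trans ?_
    rw [← ENNReal.ofReal_toReal (measure_ne_top P {ω | s < Z N ω})]
    exact ENNReal.ofReal_le_ofReal (h N)
  exact ENNReal.toReal_le_of_le_ofReal hp (h1.trans h2)

/-- The strict inequality `s' < s` absorbs the passage to the limit at the threshold. -/
lemma le_measureReal_gt_of_tendsto (hZ : ∀ N, Measurable (Z N))
    (hlim : ∀ᵐ ω ∂P, Tendsto (fun N => Z N ω) atTop (𝓝 (Y ω)))
    {s s' p : ℝ} (hs : s' < s) {N₀ : ℕ} (h : ∀ N ≥ N₀, p ≤ P.real {ω | s < Z N ω}) :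
    p ≤ P.real {ω | s' < Y ω} := by
  have h1 : P.real {ω | -s < -Y ω} ≤ 1 - p := by
    refine measureReal_gt_le_of_tendsto (Z := fun N ω => -Z (N + N₀) ω) ?_ fun N => ?_
    · filter_upwards [hlim] with ω hω
      exact (hω.comp (tendsto_add_atTop_nat N₀)).neg
    · have h2 := probReal_compl_eq_one_sub (μ := P)
        (measurableSet_lt measurable_const (hZ (N + N₀)) : MeasurableSet {ω | s < Z (N + N₀) ω})
      have h3 : P.real {ω | -s < -Z (N + N₀) ω} ≤ P.real {ω | s < Z (N + N₀) ω}ᶜ := by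
        refine measureReal_mono fun ω hω => ?_
        simp only [Set.mem_ofPred_eq, Set.mem_compl_iff, not_lt] at hω ⊢
        linarith
      linarith [h (N + N₀) (Nat.le_add_left _ _)]
  have h2 : (1 : ℝ) ≤ P.real {ω | -s < -Y ω} + P.real {ω | s' < Y ω} := by
    rw [← probReal_univ (μ := P)]
    refine (measureReal_mono fun ω _ => ?_).trans (measureReal_union_le _ _)
    rcases lt_or_ge s' (Y ω) with h | h
    · exact Or.inr h
    · exact Or.inl (by simp only [Set.mem_ofPred_eq]; linarith)
  linarith

lemma integrable_of_integrable_sq (hYm : AEStronglyMeasurable Y P)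
    (h : Integrable (fun ω => Y ω ^ 2) P) : Integrable Y P := by
  refine ((integrable_const (1 : ℝ)).add h).mono' hYm (ae_of_all _ fun ω => ?_)
  simp only [Pi.add_apply, Real.norm_eq_abs]
  nlinarith [sq_nonneg (|Y ω| - 1), sq_abs (Y ω), sq_nonneg (Y ω)]

/-- Boundedness in `L²` prevents loss of mass: if the means of the `Z N` increase, they are
bounded by the mean of the limit. -/
lemma integral_le_of_tendsto_of_monotone (hZ0 : ∀ N ω, 0 ≤ Z N ω)
    (hZ : ∀ N, Integrable (Z N) P) (hZ2 : ∀ N, Integrable (fun ω => Z N ω ^ 2) P)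
    (hlim : ∀ᵐ ω ∂P, Tendsto (fun N => Z N ω) atTop (𝓝 (Y ω)))
    {C : ℝ} (h : ∀ N, ∫ ω, Z N ω ^ 2 ∂P ≤ C) (hmono : Monotone fun N => ∫ ω, Z N ω ∂P)
    (hY : Integrable Y P) (N : ℕ) : ∫ ω, Z N ω ∂P ≤ ∫ ω, Y ω ∂P := by
  have hC : 0 ≤ C := (integral_nonneg fun ω => sq_nonneg _).trans (h 0)
  refine le_of_forall_pos_le_add fun e he => ?_
  -- truncate at a level `k` with `C / k ≤ e`
  set k : ℝ := C / e + 1 with hk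
  have hk0 : 0 < k := by positivity
  have hCk : C / k ≤ e := by
    rw [div_le_iff₀ hk0, hk]
    have : e * (C / e + 1) = C + e := by field_simp
    linarith
  have hint : ∀ M, Integrable (fun ω => min (Z M ω) k) P := fun M =>
    (hZ M).inf (integrable_const k)
  have h1 : Tendsto (fun M => ∫ ω, min (Z M ω) k ∂P) atTop (𝓝 (∫ ω, min (Y ω) k ∂P)) := by
    refine tendsto_integral_of_dominated_convergence (fun _ => k)
      (fun M => (hint M).aestronglyMeasurable) (integrable_const k) (fun M => ?_) ?_
    · refine ae_of_all _ fun ω => ?_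
      rw [Real.norm_of_nonneg (le_min (hZ0 M ω) hk0.le)]
      exact min_le_right _ _
    · filter_upwards [hlim] with ω hω
      exact hω.min tendsto_const_nhds
  have h2 : ∀ M, N ≤ M → ∫ ω, Z N ω ∂P - C / k ≤ ∫ ω, min (Z M ω) k ∂P := by
    intro M hM
    have h3 : ∫ ω, Z M ω ∂P ≤ ∫ ω, (min (Z M ω) k + Z M ω ^ 2 / k) ∂P := by
      refine integral_mono (hZ M) ((hint M).add ((hZ2 M).div_const k)) fun ω => ?_
      simp only
      rcases le_total (Z M ω) k with h | h
      · rw [min_eq_left h]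
        have : 0 ≤ Z M ω ^ 2 / k := by positivity
        linarith
      · rw [min_eq_right h]
        have : Z M ω ≤ Z M ω ^ 2 / k := by
          rw [le_div_iff₀ hk0, sq]
          exact mul_le_mul_of_nonneg_left h (hZ0 M ω)
        linarith
    rw [integral_add (hint M) ((hZ2 M).div_const k), integral_div] at h3
    have h4 : (∫ ω, Z M ω ^ 2 ∂P) / k ≤ C / k := div_le_div_of_nonneg_right (h M) hk0.le
    have h5 := hmono hM
    simp only at h5
    linarith
  have h6 := ge_of_tendsto h1 (eventually_atTop.2 ⟨N, fun M hM => h2 M hM⟩)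
  have h7 : ∫ ω, min (Y ω) k ∂P ≤ ∫ ω, Y ω ∂P :=
    integral_mono (hY.inf (integrable_const k)) hY fun ω => min_le_left _ _
  linarith

/-- Markov's inequality, in a form that is valid also for `e = 0`. -/
lemma half_le_measureReal_le_two_mul (hYm : Measurable Y) (hY0 : ∀ ω, 0 ≤ Y ω)
    (hY : Integrable Y P) {e : ℝ} (he : ∫ ω, Y ω ∂P ≤ e) : 1 / 2 ≤ P.real {ω | Y ω ≤ 2 * e} := by
  rcases ((integral_nonneg hY0).trans he).eq_or_lt with h | h
  · have h1 : Y =ᵐ[P] 0 := (integral_eq_zero_iff_of_nonneg hY0 hY).1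
      (le_antisymm (h ▸ he) (integral_nonneg hY0))
    have h2 : P.real {ω | Y ω ≤ 2 * e} = 1 := by
      rw [← probReal_univ (μ := P)]
      refine measureReal_congr (eventuallyEq_set.2 ?_)
      filter_upwards [h1] with ω hω
      simp [hω, ← h]
    rw [h2]; norm_num
  · have h1 := mul_meas_ge_le_integral_of_nonneg (ae_of_all P hY0) hY (2 * e)
    have h2 := probReal_compl_eq_one_sub (μ := P)
      (measurableSet_le hYm measurable_const : MeasurableSet {ω | Y ω ≤ 2 * e})
    have h3 : P.real {ω | Y ω ≤ 2 * e}ᶜ ≤ P.real {ω | 2 * e ≤ Y ω} := by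
      refine measureReal_mono fun ω hω => ?_
      simp only [Set.mem_ofPred_eq, Set.mem_compl_iff, not_le] at hω ⊢
      exact hω.le
    have h4 : P.real {ω | 2 * e ≤ Y ω} ≤ 1 / 2 := by
      refine le_of_mul_le_mul_left (a := 2 * e) ?_ (by positivity)
      linarith
    linarith

/-- Paley–Zygmund inequality at three quarters of the mean. -/
lemma le_measureReal_gt_three_quarters (hYm : AEStronglyMeasurable Y P) (hY : Integrable Y P)
    (hY2 : Integrable (fun ω => Y ω ^ 2) P) {e C : ℝ} (he : ∫ ω, Y ω ∂P = e) (he0 : 0 < e)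
    (hC : 0 < C) (h : ∫ ω, Y ω ^ 2 ∂P ≤ C * e ^ 2) :
    1 / (16 * C) ≤ P.real {ω | 3 / 4 * e < Y ω} := by
  have hms : NullMeasurableSet {ω | 3 / 4 * e < Y ω} P :=
    nullMeasurableSet_lt aemeasurable_const hYm.aemeasurable
  have hind : Integrable ({ω | 3 / 4 * e < Y ω}.indicator fun _ => (1 : ℝ)) P :=
    (integrable_const (1 : ℝ)).indicator₀ hms
  have hintI : ∫ ω, ({ω | 3 / 4 * e < Y ω}.indicator fun _ => (1 : ℝ)) ω ∂P =
      P.real {ω | 3 / 4 * e < Y ω} := by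
    rw [integral_indicator₀ hms]
    simp
  -- `y ≤ y² / (8 C e) + 2 C e` bounds `y` on the event
  have key : ∀ ω, Y ω ≤ 3 / 4 * e + 1 / (8 * C * e) * Y ω ^ 2 +
      2 * C * e * ({ω | 3 / 4 * e < Y ω}.indicator fun _ => (1 : ℝ)) ω := by
    intro ω
    have h1 : 0 ≤ 1 / (8 * C * e) * Y ω ^ 2 := by positivity
    by_cases hω : 3 / 4 * e < Y ω
    · rw [Set.indicator_of_mem (by exact hω)]
      have h2 : 0 ≤ 1 / (8 * C * e) * (Y ω - 4 * C * e) ^ 2 := by positivity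
      have h3 : 1 / (8 * C * e) * (Y ω - 4 * C * e) ^ 2 =
          1 / (8 * C * e) * Y ω ^ 2 - Y ω + 2 * C * e := by field_simp; ring
      linarith
    · rw [Set.indicator_of_notMem (by exact hω)]
      linarith
  have h1 := integral_mono hY ((((integrable_const (3 / 4 * e)).add
    (hY2.const_mul (1 / (8 * C * e)))).add (hind.const_mul (2 * C * e)))) key
  rw [integral_add' ((integrable_const _).add (hY2.const_mul _)) (hind.const_mul _),
    integral_add' (integrable_const _) (hY2.const_mul _), integral_const_mul (1 / (8 * C * e)),
    integral_const_mul (2 * C * e), hintI, he] at h1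
  simp only [integral_const, probReal_univ, smul_eq_mul, one_mul] at h1
  have h2 := mul_le_mul_of_nonneg_left h (by positivity : 0 ≤ 1 / (8 * C * e))
  have h3 : 1 / (8 * C * e) * (C * e ^ 2) = e / 8 := by field_simp
  rw [div_le_iff₀ (by positivity)]
  refine le_of_mul_le_mul_left (a := e) ?_ he0
  linarith

end Limits

/-! ### The K-functional of a scalar sequence -/

section KFunctional

variable {𝕜 : Type*} [RCLike 𝕜]

lemma sum_norm_le_lp_one (b : lp (fun _ : ℕ => 𝕜) 1) (s : Finset ℕ) :
    ∑ n ∈ s, ‖b n‖ ≤ ‖b‖ := by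
  have h := lp.sum_rpow_le_norm_rpow (p := 1) (by norm_num) b s
  simpa using h

lemma sum_norm_sq_le_lp_two (c : lp (fun _ : ℕ => 𝕜) 2) (s : Finset ℕ) :
    ∑ n ∈ s, ‖c n‖ ^ 2 ≤ ‖c‖ ^ 2 := by
  have h := lp.sum_rpow_le_norm_rpow (p := 2) (by norm_num) c s
  simpa using h

lemma kFunctional12_nonneg (a : ℕ → 𝕜) {t : ℝ} (ht : 0 ≤ t) : 0 ≤ kFunctional12 a t := by
  refine Real.sInf_nonneg ?_
  rintro r ⟨b, c, -, rfl⟩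
  positivity

lemma kFunctional12_le {a : ℕ → 𝕜} {t : ℝ} (ht : 0 ≤ t) (b : lp (fun _ : ℕ => 𝕜) 1)
    (c : lp (fun _ : ℕ => 𝕜) 2) (h : ∀ n, a n = b n + c n) :
    kFunctional12 a t ≤ ‖b‖ + t * ‖c‖ := by
  refine csInf_le ⟨0, ?_⟩ ⟨b, c, h, rfl⟩
  rintro r ⟨b, c, -, rfl⟩
  positivity

lemma kFunctional12_le_norm {t : ℝ} (ht : 0 ≤ t) (g : lp (fun _ : ℕ => 𝕜) 2) :
    kFunctional12 (fun n => g n) t ≤ t * ‖g‖ := by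
  simpa using kFunctional12_le ht 0 g (fun n => by simp)

/-- A lower bound for all decompositions bounds the K-functional of a square summable sequence
from below. -/
lemma le_kFunctional12 {a : ℕ → 𝕜} (ha : Memℓp a 2) {t r : ℝ}
    (h : ∀ (b : lp (fun _ : ℕ => 𝕜) 1) (c : lp (fun _ : ℕ => 𝕜) 2), (∀ n, a n = b n + c n) →
      r ≤ ‖b‖ + t * ‖c‖) : r ≤ kFunctional12 a t := by
  refine le_csInf ⟨_, 0, ⟨a, ha⟩, fun n => by simp, rfl⟩ ?_
  rintro _ ⟨b, c, hbc, rfl⟩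
  exact h b c hbc

lemma kFunctional12_pos {a : ℕ → 𝕜} (ha : Memℓp a 2) {t : ℝ} (ht : 0 < t) {n : ℕ}
    (hn : a n ≠ 0) : 0 < kFunctional12 a t := by
  have h0 : 0 < min 1 t * ‖a n‖ := mul_pos (lt_min one_pos ht) (norm_pos_iff.2 hn)
  refine h0.trans_le (le_kFunctional12 ha fun b c h => ?_)
  have h1 := sum_norm_le_lp_one b {n}
  have h2 := Real.sqrt_le_sqrt (sum_norm_sq_le_lp_two c {n})
  rw [Finset.sum_singleton] at h1 h2
  rw [Real.sqrt_sq (norm_nonneg _), Real.sqrt_sq (norm_nonneg _)] at h2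
  calc min 1 t * ‖a n‖ ≤ min 1 t * (‖b n‖ + ‖c n‖) := by
        rw [h n]; gcongr; exact norm_add_le _ _
    _ ≤ 1 * ‖b n‖ + t * ‖c n‖ := by
        rw [mul_add]; gcongr
        · exact min_le_left _ _
        · exact min_le_right _ _
    _ ≤ ‖b‖ + t * ‖c‖ := by rw [one_mul]; gcongr

/-- Duality: a finite sequence `d` with `‖d‖_∞ ≤ 2` and `‖d‖₂ ≤ t` pairs with `a` to at most
`2 K(a, t)`. -/
lemma norm_sum_mul_le_two_mul_kFunctional12 {a : ℕ → 𝕜} (ha : Memℓp a 2) {t : ℝ} (ht : 0 ≤ t)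
    (N : ℕ) (d : ℕ → ℝ) (hd : ∀ i < N, |d i| ≤ 2)
    (hdt : ∑ i ∈ Finset.range N, d i ^ 2 ≤ t ^ 2) :
    ‖∑ i ∈ Finset.range N, (d i : 𝕜) * a i‖ ≤ 2 * kFunctional12 a t := by
  suffices h : ‖∑ i ∈ Finset.range N, (d i : 𝕜) * a i‖ / 2 ≤ kFunctional12 a t by linarith
  refine le_kFunctional12 ha fun b c h => ?_
  have h1 : ∑ i ∈ Finset.range N, |d i| * ‖b i‖ ≤ 2 * ‖b‖ := by
    calc _ ≤ ∑ i ∈ Finset.range N, 2 * ‖b i‖ := Finset.sum_le_sum fun i hi => by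
          gcongr; exact hd i (Finset.mem_range.1 hi)
      _ ≤ 2 * ‖b‖ := by
          rw [← Finset.mul_sum]; gcongr; exact sum_norm_le_lp_one b _
  have h2 : ∑ i ∈ Finset.range N, |d i| * ‖c i‖ ≤ t * ‖c‖ := by
    refine abs_le_of_sq_le_sq' ?_ (by positivity) |>.2
    refine (Finset.sum_mul_sq_le_sq_mul_sq _ _ _).trans ?_
    simp only [sq_abs]
    rw [mul_pow]
    gcongr
    exact sum_norm_sq_le_lp_two c _
  have h3 : ‖∑ i ∈ Finset.range N, (d i : 𝕜) * a i‖ ≤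
      ∑ i ∈ Finset.range N, |d i| * ‖b i‖ + ∑ i ∈ Finset.range N, |d i| * ‖c i‖ := by
    rw [← Finset.sum_add_distrib]
    refine norm_sum_le_of_le _ fun i _ => ?_
    rw [norm_mul, RCLike.norm_ofReal, h i, ← mul_add]
    gcongr
    exact norm_add_le _ _
  have := mul_nonneg ht (norm_nonneg c)
  linarith

lemma lp_sum_single_apply (p : ℝ≥0∞) (a : ℕ → 𝕜) (T : Finset ℕ) (n : ℕ) :
    (∑ i ∈ T, lp.single (E := fun _ : ℕ => 𝕜) p i (a i)) n = if n ∈ T then a n else 0 := by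
  simp only [lp.coeFn_sum, Finset.sum_apply, lp.coeFn_single, Finset.sum_pi_single]

lemma norm_lp_one_sum_single_le (a : ℕ → 𝕜) (T : Finset ℕ) :
    ‖∑ i ∈ T, lp.single (E := fun _ : ℕ => 𝕜) 1 i (a i)‖ ≤ ∑ i ∈ T, ‖a i‖ := by
  refine norm_sum_le_of_le _ fun i _ => ?_
  rw [lp.norm_single one_pos]

lemma norm_lp_two_sum_single (a : ℕ → 𝕜) (T : Finset ℕ) :
    ‖∑ i ∈ T, lp.single (E := fun _ : ℕ => 𝕜) 2 i (a i)‖ = √(∑ i ∈ T, ‖a i‖ ^ 2) := by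
  have h := lp.norm_sum_single (E := fun _ : ℕ => 𝕜) (p := 2) (by norm_num) a T
  rw [eq_comm, Real.sqrt_eq_iff_mul_self_eq (Finset.sum_nonneg fun _ _ => by positivity)
    (norm_nonneg _), ← sq, eq_comm]
  simpa using h

/-- Up to `η`, the K-functional is bounded by any two finite decompositions of the real and
imaginary parts of a long initial segment. -/
lemma exists_kFunctional12_le_add {a : ℕ → 𝕜} (ha : Memℓp a 2) {t η : ℝ} (ht : 0 ≤ t)
    (hη : 0 < η) :
    ∃ N : ℕ, ∀ T ⊆ Finset.range N, ∀ T' ⊆ Finset.range N,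
      kFunctional12 a t ≤ η +
        (∑ n ∈ T, |RCLike.re (a n)| + t * √(∑ n ∈ Finset.range N \ T, RCLike.re (a n) ^ 2)) +
        (∑ n ∈ T', |RCLike.im (a n)| + t * √(∑ n ∈ Finset.range N \ T', RCLike.im (a n) ^ 2)) := by
  obtain ⟨g, hg⟩ : ∃ g : lp (fun _ : ℕ => 𝕜) 2, ∀ n, g n = a n := ⟨⟨a, ha⟩, fun _ => rfl⟩
  have hsum := (lp.hasSum_single (by norm_num) g).tendsto_sum_nat
  have htend : Tendsto (fun N => t * ‖g - ∑ i ∈ Finset.range N, lp.single 2 i (g i)‖) atTop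
      (𝓝 0) := by
    simpa using ((tendsto_const_nhds (x := g)).sub hsum).norm.const_mul t
  obtain ⟨N, hN⟩ := (htend.eventually (gt_mem_nhds hη)).exists
  refine ⟨N, fun T hT T' hT' => ?_⟩
  let u : ℕ → 𝕜 := fun n => (RCLike.re (a n) : 𝕜)
  let v : ℕ → 𝕜 := fun n => (RCLike.im (a n) : 𝕜) * RCLike.I
  have huv : ∀ n, a n = u n + v n := fun n => (RCLike.re_add_im (a n)).symm
  have hu : ∀ n, ‖u n‖ = |RCLike.re (a n)| := fun n => RCLike.norm_ofReal _
  have hv : ∀ n, ‖v n‖ ≤ |RCLike.im (a n)| := fun n => by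
    rw [norm_mul, RCLike.norm_ofReal]
    refine mul_le_of_le_one_right (abs_nonneg _) ?_
    rw [RCLike.norm_I]
    split_ifs <;> norm_num
  have hK := kFunctional12_le ht
    (∑ i ∈ T, lp.single (E := fun _ : ℕ => 𝕜) 1 i (u i) +
      ∑ i ∈ T', lp.single (E := fun _ : ℕ => 𝕜) 1 i (v i))
    ((g - ∑ i ∈ Finset.range N, lp.single 2 i (g i)) +
      ∑ i ∈ Finset.range N \ T, lp.single (E := fun _ : ℕ => 𝕜) 2 i (u i) +
      ∑ i ∈ Finset.range N \ T', lp.single (E := fun _ : ℕ => 𝕜) 2 i (v i)) (a := a) (by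
    intro n
    have h1 := @hT n
    have h2 := @hT' n
    simp only [lp.coeFn_add, lp.coeFn_sub, Pi.add_apply, Pi.sub_apply]
    rw [lp_sum_single_apply, lp_sum_single_apply, lp_sum_single_apply, lp_sum_single_apply,
      lp_sum_single_apply, hg, huv n]
    simp only [Finset.mem_sdiff]
    by_cases hr : n ∈ Finset.range N <;> by_cases hnT : n ∈ T <;> by_cases hnT' : n ∈ T' <;>
      simp only [hr, hnT, hnT', if_true, if_false, not_true, not_false_iff, and_true, and_false,
        true_implies, false_implies, imp_false] at h1 h2 ⊢ <;> ring)
  refine hK.trans ?_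
  have e1 : ‖∑ i ∈ T, lp.single (E := fun _ : ℕ => 𝕜) 1 i (u i) +
      ∑ i ∈ T', lp.single (E := fun _ : ℕ => 𝕜) 1 i (v i)‖ ≤
      ∑ n ∈ T, |RCLike.re (a n)| + ∑ n ∈ T', |RCLike.im (a n)| := by
    refine norm_add_le_of_le ((norm_lp_one_sum_single_le u T).trans ?_)
      ((norm_lp_one_sum_single_le v T').trans ?_)
    · exact Finset.sum_le_sum fun n _ => (hu n).le
    · exact Finset.sum_le_sum fun n _ => hv n
  have e2 : ‖(g - ∑ i ∈ Finset.range N, lp.single 2 i (g i)) +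
      ∑ i ∈ Finset.range N \ T, lp.single (E := fun _ : ℕ => 𝕜) 2 i (u i) +
      ∑ i ∈ Finset.range N \ T', lp.single (E := fun _ : ℕ => 𝕜) 2 i (v i)‖ ≤
      ‖g - ∑ i ∈ Finset.range N, lp.single 2 i (g i)‖ +
      √(∑ n ∈ Finset.range N \ T, RCLike.re (a n) ^ 2) +
      √(∑ n ∈ Finset.range N \ T', RCLike.im (a n) ^ 2) := by
    refine norm_add₃_le.trans ?_
    rw [norm_lp_two_sum_single, norm_lp_two_sum_single]
    gcongr _ + √(∑ n ∈ _, ?_) + √(∑ n ∈ _, ?_) with n hn n hn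
    · rw [hu, sq_abs]
    · rw [← sq_abs (RCLike.im (a n))]
      exact pow_le_pow_left₀ (norm_nonneg _) (hv n) 2
  have e3 := mul_le_mul_of_nonneg_left e2 ht
  linarith

end KFunctional

/-! ### The weak K-functional and vector-valued series -/

section WeakKFunctional

variable {𝕜 : Type*} [RCLike 𝕜]

lemma exists_lp_two_norm_le {a : ℕ → 𝕜} {C : ℝ} (hC : 0 ≤ C)
    (h : ∀ N, ∑ n ∈ Finset.range N, ‖a n‖ ^ 2 ≤ C ^ 2) :
    ∃ g : lp (fun _ : ℕ => 𝕜) 2, (∀ n, g n = a n) ∧ ‖g‖ ≤ C := by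
  have h' : ∀ s : Finset ℕ, ∑ n ∈ s, ‖a n‖ ^ (2 : ℝ≥0∞).toReal ≤ C ^ (2 : ℝ≥0∞).toReal := by
    intro s
    obtain ⟨N, hN⟩ := s.exists_nat_subset_range
    simpa using (Finset.sum_le_sum_of_subset_of_nonneg hN fun n _ _ => by positivity).trans (h N)
  exact ⟨⟨a, memℓp_gen' h'⟩, fun _ => rfl, lp.norm_le_of_forall_sum_le (by norm_num) hC h'⟩

variable {E : Type*} [NormedAddCommGroup E] [NormedSpace 𝕜 E] {x : ℕ → E}

/-- Bounds on the dual unit ball suffice, by homogeneity. -/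
lemma isWeaklyL2_of_sum_le {C : ℝ}
    (h : ∀ f : StrongDual 𝕜 E, ‖f‖ ≤ 1 → ∀ N, ∑ n ∈ Finset.range N, ‖f (x n)‖ ^ 2 ≤ C ^ 2) :
    IsWeaklyL2 𝕜 x := by
  intro f
  have hr0 : (0 : ℝ) < ‖f‖ + 1 := by positivity
  set r : 𝕜 := ((‖f‖ + 1 : ℝ) : 𝕜) with hr
  have hrne : r ≠ 0 := by rw [hr]; exact_mod_cast hr0.ne'
  have hnr : ‖r‖ = ‖f‖ + 1 := by rw [hr, RCLike.norm_ofReal, abs_of_pos hr0]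
  have hf : ‖r⁻¹ • f‖ ≤ 1 := by
    rw [norm_smul, norm_inv, hnr, inv_mul_le_iff₀ hr0]
    linarith
  obtain ⟨g, hg, -⟩ := exists_lp_two_norm_le (abs_nonneg C)
    (fun N => by rw [sq_abs]; exact h _ hf N)
  have hmem := (lp.memℓp g).const_smul r
  convert hmem using 1
  ext n
  rw [Pi.smul_apply, hg, smul_eq_mul]
  simp [hrne]

lemma bddAbove_kFunctional12 {C : ℝ} (hC : 0 ≤ C)
    (h : ∀ f : StrongDual 𝕜 E, ‖f‖ ≤ 1 → ∀ N, ∑ n ∈ Finset.range N, ‖f (x n)‖ ^ 2 ≤ C ^ 2)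
    {t : ℝ} (ht : 0 ≤ t) :
    BddAbove (Set.range fun f : {f : StrongDual 𝕜 E // ‖f‖ ≤ 1} =>
      kFunctional12 (fun n => f.1 (x n)) t) := by
  refine ⟨t * C, ?_⟩
  rintro _ ⟨f, rfl⟩
  obtain ⟨g, hg, hgC⟩ := exists_lp_two_norm_le hC (h f.1 f.2)
  have := kFunctional12_le_norm ht g
  simp only [hg] at this
  exact this.trans (by gcongr)

lemma weakKFunctional12_nonneg {t : ℝ} (ht : 0 ≤ t) : 0 ≤ weakKFunctional12 𝕜 x t :=
  Real.iSup_nonneg fun _ => kFunctional12_nonneg _ ht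

variable [NormedSpace ℝ E] [IsScalarTower ℝ 𝕜 E]

lemma norm_sum_smul_le_two_mul_weakKFunctional12 (hx : IsWeaklyL2 𝕜 x) {t : ℝ} (ht : 0 ≤ t)
    (hb : BddAbove (Set.range fun f : {f : StrongDual 𝕜 E // ‖f‖ ≤ 1} =>
      kFunctional12 (fun n => f.1 (x n)) t)) (N : ℕ) (d : ℕ → ℝ) (hd : ∀ i < N, |d i| ≤ 2)
    (hdt : ∑ i ∈ Finset.range N, d i ^ 2 ≤ t ^ 2) :
    ‖∑ i ∈ Finset.range N, d i • x i‖ ≤ 2 * weakKFunctional12 𝕜 x t := by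
  obtain ⟨f, hf, hfv⟩ := exists_dual_vector'' 𝕜 (∑ i ∈ Finset.range N, d i • x i)
  have h1 : f (∑ i ∈ Finset.range N, d i • x i) = ∑ i ∈ Finset.range N, (d i : 𝕜) * f (x i) := by
    have h : ∀ r : ℝ, ∀ y : E, f (r • y) = r • f y := fun r y =>
      (f.restrictScalars ℝ).map_smul r y
    simp [map_sum, h, RCLike.real_smul_eq_coe_mul]
  have h2 := norm_sum_mul_le_two_mul_kFunctional12 (hx f) ht N d hd hdt
  rw [← h1, hfv, RCLike.norm_ofReal, abs_of_nonneg (norm_nonneg _)] at h2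
  have h3 := le_ciSup hb ⟨f, hf⟩
  refine h2.trans ?_
  unfold weakKFunctional12
  gcongr

lemma re_sum_smul (f : StrongDual 𝕜 E) (s : Finset ℕ) (d : ℕ → ℝ) :
    RCLike.re (f (∑ n ∈ s, d n • x n)) = ∑ n ∈ s, d n * RCLike.re (f (x n)) := by
  have h : ∀ r : ℝ, ∀ y : E, f (r • y) = r • f y := fun r y =>
    (f.restrictScalars ℝ).map_smul r y
  simp [map_sum, h, RCLike.smul_re]

lemma im_sum_smul (f : StrongDual 𝕜 E) (s : Finset ℕ) (d : ℕ → ℝ) :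
    RCLike.im (f (∑ n ∈ s, d n • x n)) = ∑ n ∈ s, d n * RCLike.im (f (x n)) := by
  have h : ∀ r : ℝ, ∀ y : E, f (r • y) = r • f y := fun r y =>
    (f.restrictScalars ℝ).map_smul r y
  simp [map_sum, h, RCLike.smul_im]

end WeakKFunctional

lemma exp_le_pow_ceil (s : ℝ) (hs : 0 ≤ s) :
    Real.exp (-(3 * s + 6)) ≤ (3 / 32 : ℝ) ^ (⌈s⌉₊ + 1) := by
  have h1 : Real.exp (-3) ≤ 3 / 32 := by
    rw [Real.exp_neg, inv_le_comm₀ (Real.exp_pos _) (by norm_num)]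
    have h2 : Real.exp 3 = Real.exp 1 ^ 3 := by rw [← Real.exp_nat_mul]; norm_num
    rw [h2]
    calc ((3 : ℝ) / 32)⁻¹ ≤ 2.7 ^ 3 := by norm_num
      _ ≤ Real.exp 1 ^ 3 := by
        gcongr
        exact le_of_lt (lt_of_le_of_lt (by norm_num) Real.exp_one_gt_d9)
  calc Real.exp (-(3 * s + 6)) ≤ Real.exp ((⌈s⌉₊ + 1 : ℕ) * (-3)) := by
        rw [Real.exp_le_exp]
        have := Nat.ceil_lt_add_one hs
        push_cast
        linarith
    _ = Real.exp (-3) ^ (⌈s⌉₊ + 1) := Real.exp_nat_mul _ _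
    _ ≤ _ := by gcongr

section Assembly

variable {𝕜 : Type*} [RCLike 𝕜] {E : Type*} [NormedAddCommGroup E] [NormedSpace ℝ E]
  {Ω : Type*} [MeasurableSpace Ω] {P : Measure Ω} {ε : ℕ → Ω → ℝ} {x : ℕ → E}

lemma IsRademacherSequence.measurable_norm_sum (hε : IsRademacherSequence P ε) (x : ℕ → E)
    (N : ℕ) : Measurable fun ω => ‖∑ n ∈ Finset.range N, ε n ω • x n‖ := by
  have h : Continuous fun y : Fin N → ℝ => ‖∑ i, y i • x i‖ := by fun_prop
  simp only [Finset.sum_range]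
  exact h.measurable.comp (measurable_pi_lambda _ fun i : Fin N => hε.measurable i)

variable [IsProbabilityMeasure P]

/-- The partial sums of an almost surely convergent series have a common bound up to small
probability. -/
lemma IsRademacherSequence.exists_measureReal_norm_gt_lt (hε : IsRademacherSequence P ε)
    {X : Ω → E}
    (hX : ∀ᵐ ω ∂P, Tendsto (fun N => ∑ n ∈ Finset.range N, ε n ω • x n) atTop (𝓝 (X ω))) :
    ∃ R : ℝ, ∀ N, P.real {ω | R < ‖∑ n ∈ Finset.range N, ε n ω • x n‖} < 3 / 16 := by
  let D : ℕ → Set Ω := fun k => ⋃ N, {ω | (k : ℝ) < ‖∑ n ∈ Finset.range N, ε n ω • x n‖}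
  have hDm : ∀ k, MeasurableSet (D k) := fun k => MeasurableSet.iUnion fun N =>
    measurableSet_lt measurable_const (hε.measurable_norm_sum x N)
  have hanti : Antitone D := fun k l hkl => Set.iUnion_mono fun N ω hω => by
    simp only [Set.mem_ofPred_eq] at hω ⊢
    exact lt_of_le_of_lt (Nat.cast_le.2 hkl) hω
  have hzero : P (⋂ k, D k) = 0 := by
    refine measure_mono_null ?_ hX
    intro ω hω hlim
    obtain ⟨B, hB⟩ := hlim.norm.bddAbove_range
    obtain ⟨k, hk⟩ := exists_nat_ge B
    obtain ⟨N, hN⟩ := Set.mem_iUnion.1 (Set.mem_iInter.1 hω k)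
    exact absurd (hB ⟨N, rfl⟩) (not_le.2 (lt_of_le_of_lt hk hN))
  have htend := tendsto_measure_iInter_atTop (μ := P) (fun k => (hDm k).nullMeasurableSet) hanti
    ⟨0, measure_ne_top P _⟩
  rw [hzero] at htend
  have htend' := (ENNReal.tendsto_toReal ENNReal.zero_ne_top).comp htend
  obtain ⟨k, hk⟩ := (htend'.eventually_lt_const
    (show ENNReal.toReal 0 < 3 / 16 by norm_num)).exists
  refine ⟨k, fun N => lt_of_le_of_lt (measureReal_mono ?_) hk⟩
  exact Set.subset_iUnion (fun N => {ω | (k : ℝ) < ‖∑ n ∈ Finset.range N, ε n ω • x n‖}) N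

variable [NormedSpace 𝕜 E] [IsScalarTower ℝ 𝕜 E]

lemma IsRademacherSequence.sum_norm_sq_le_of_measureReal_lt (hε : IsRademacherSequence P ε)
    {R : ℝ} {N : ℕ} (hR : P.real {ω | R < ‖∑ n ∈ Finset.range N, ε n ω • x n‖} < 3 / 16)
    (f : StrongDual 𝕜 E) (hf : ‖f‖ ≤ 1) :
    ∑ n ∈ Finset.range N, ‖f (x n)‖ ^ 2 ≤ 8 * R ^ 2 := by
  have hle : ∀ y, ‖f y‖ ≤ 1 * ‖y‖ := fun y => f.le_of_opNorm_le hf y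
  have h1 := hε.sum_sq_le_of_measureReal_lt x N hR
    ((RCLike.reCLM (K := 𝕜)).comp (f.restrictScalars ℝ))
    (ContinuousLinearMap.opNorm_le_bound _ zero_le_one fun y =>
      (RCLike.abs_re_le_norm (f y)).trans (hle y))
  have h2 := hε.sum_sq_le_of_measureReal_lt x N hR
    ((RCLike.imCLM (K := 𝕜)).comp (f.restrictScalars ℝ))
    (ContinuousLinearMap.opNorm_le_bound _ zero_le_one fun y =>
      (RCLike.abs_im_le_norm (f y)).trans (hle y))
  have h3 : ∀ z : 𝕜, ‖z‖ ^ 2 = RCLike.re z ^ 2 + RCLike.im z ^ 2 := fun z => by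
    rw [RCLike.norm_sq_eq_def, sq, sq]
  simp only [h3, Finset.sum_add_distrib]
  simp only [ContinuousLinearMap.comp_apply, ContinuousLinearMap.coe_restrictScalars',
    RCLike.reCLM_apply, RCLike.imCLM_apply] at h1 h2
  linarith

/-- Lower tail estimate through a single functional of norm at most `1`. The real or the
imaginary part of `f (S_N)` accounts for half of the K-functional. -/
lemma IsRademacherSequence.exists_le_measureReal_norm_gt (hε : IsRademacherSequence P ε)
    {f : StrongDual 𝕜 E} (hf : ‖f‖ ≤ 1) (hmem : Memℓp (fun n => f (x n)) 2) {t : ℝ} (ht : 0 ≤ t)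
    (hpos : 0 < kFunctional12 (fun n => f (x n)) t) :
    ∃ N, (3 / 32 : ℝ) ^ (⌈t ^ 2⌉₊ + 1) ≤
      P.real {ω | kFunctional12 (fun n => f (x n)) t / 25 <
        ‖∑ n ∈ Finset.range N, ε n ω • x n‖} := by
  set K := kFunctional12 (fun n => f (x n)) t with hK
  obtain ⟨N, hN⟩ := exists_kFunctional12_le_add hmem ht (half_pos hpos)
  refine ⟨N, ?_⟩
  obtain ⟨T, hT, r, hr, hle⟩ := hε.exists_pow_le_measureReal (fun n => RCLike.re (f (x n)))
    ⌈t ^ 2⌉₊ (Finset.range N)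
  obtain ⟨T', hT', r', hr', hle'⟩ := hε.exists_pow_le_measureReal (fun n => RCLike.im (f (x n)))
    ⌈t ^ 2⌉₊ (Finset.range N)
  have h := hN T hT T' hT'
  -- `⌈t²⌉` blocks are used, so that `t` is at most the square root of their number
  have htm : t ≤ √(⌈t ^ 2⌉₊ : ℝ) := Real.le_sqrt_of_sq_le (Nat.le_ceil _)
  have h1 := mul_le_mul_of_nonneg_right htm
    (Real.sqrt_nonneg (∑ n ∈ Finset.range N \ T, RCLike.re (f (x n)) ^ 2))
  have h2 := mul_le_mul_of_nonneg_right htm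
    (Real.sqrt_nonneg (∑ n ∈ Finset.range N \ T', RCLike.im (f (x n)) ^ 2))
  have h3 : K ≤ 12 * r + 12 * r' := by linarith
  have hfle : ∀ y, ‖f y‖ ≤ ‖y‖ := fun y => by simpa using f.le_of_opNorm_le hf y
  rcases le_total (K / 24) r with h4 | h4
  · refine hr.trans (measureReal_mono fun ω hω => ?_)
    simp only [Set.mem_ofPred_eq] at hω ⊢
    rw [← re_sum_smul f] at hω
    have := (RCLike.re_le_norm (f (∑ n ∈ Finset.range N, ε n ω • x n))).trans (hfle _)
    linarith
  · refine hr'.trans (measureReal_mono fun ω hω => ?_)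
    simp only [Set.mem_ofPred_eq] at hω ⊢
    rw [← im_sum_smul f] at hω
    have := (RCLike.im_le_norm (f (∑ n ∈ Finset.range N, ε n ω • x n))).trans (hfle _)
    linarith

/-- The tail estimates, with explicit constant, for signs acting by real scalar multiplication. -/
theorem IsRademacherSequence.tail_estimates (hε : IsRademacherSequence P ε) {X : Ω → E}
    (hX : ∀ᵐ ω ∂P, Tendsto (fun N => ∑ n ∈ Finset.range N, ε n ω • x n) atTop (𝓝 (X ω))) :
    Integrable (fun ω => ‖X ω‖) P ∧ IsWeaklyL2 𝕜 x ∧ ∀ t : ℝ, 0 < t →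
      BddAbove (Set.range fun f : {f : StrongDual 𝕜 E // ‖f‖ ≤ 1} =>
        kFunctional12 (fun n => f.1 (x n)) t) ∧
      P.real {ω | ‖X ω‖ > 2 * (∫ ω', ‖X ω'‖ ∂P) + 6 * weakKFunctional12 𝕜 x t}
        ≤ 4 * Real.exp (-t ^ 2 / 8) ∧
      ((∃ n, x n ≠ 0) →
        P.real {ω | ‖X ω‖ > 1 / 2 * (∫ ω', ‖X ω'‖ ∂P) + 1 / 100000 * weakKFunctional12 𝕜 x t}
          ≥ 1 / 100000 * Real.exp (-t ^ 2 / (1 / 100000))) := by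
  have hlim : ∀ᵐ ω ∂P, Tendsto (fun N => ‖∑ n ∈ Finset.range N, ε n ω • x n‖) atTop
      (𝓝 ‖X ω‖) := by
    filter_upwards [hX] with ω hω using hω.norm
  have hm := hε.measurable_norm_sum x
  have hi := hε.integrable_norm x
  have hi2 := hε.integrable_norm_sq x
  obtain ⟨R, hR⟩ := hε.exists_measureReal_norm_gt_lt hX
  have hC : ∀ f : StrongDual 𝕜 E, ‖f‖ ≤ 1 → ∀ N,
      ∑ n ∈ Finset.range N, ‖f (x n)‖ ^ 2 ≤ (3 * |R|) ^ 2 := fun f hf N => by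
    refine (hε.sum_norm_sq_le_of_measureReal_lt (hR N) f hf).trans ?_
    rw [mul_pow, sq_abs]
    nlinarith [sq_nonneg R]
  have hsq := fun N => hε.integral_norm_sq_le_of_measureReal_lt x N (hR N)
  obtain ⟨hX2, -⟩ := integrable_sq_of_tendsto hm hi2 hlim hsq
  have hXm : AEStronglyMeasurable (fun ω => ‖X ω‖) P :=
    aestronglyMeasurable_of_tendsto_ae atTop (fun N => (hm N).aestronglyMeasurable) hlim
  have hXi := integrable_of_integrable_sq hXm hX2
  have hle := integral_le_of_tendsto_of_monotone (fun _ _ => norm_nonneg _) hi hi2 hlim hsq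
    (hε.integral_norm_mono x) hXi
  have hweak : IsWeaklyL2 𝕜 x := isWeaklyL2_of_sum_le hC
  refine ⟨hXi, hweak, fun t ht => ?_⟩
  have hb := bddAbove_kFunctional12 (by positivity) hC ht.le
  have hK0 := weakKFunctional12_nonneg (𝕜 := 𝕜) (x := x) ht.le
  set K := weakKFunctional12 𝕜 x t with hK
  set e := ∫ ω, ‖X ω‖ ∂P with he
  refine ⟨hb, ?_, fun ⟨n, hn⟩ => ?_⟩
  · have h1 : P.real {ω | 2 * e + 2 * K < ‖X ω‖} ≤ 2 * Real.exp (-t ^ 2 / 8) :=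
      measureReal_gt_le_of_tendsto hlim fun N => hε.measureReal_norm_gt_le_exp x N
        (half_le_measureReal_le_two_mul (hm N) (fun _ => norm_nonneg _) (hi N) (hle N))
        (norm_sum_smul_le_two_mul_weakKFunctional12 hweak ht.le hb N)
    calc _ ≤ P.real {ω | 2 * e + 2 * K < ‖X ω‖} := by
          refine measureReal_mono fun ω hω => ?_
          simp only [Set.mem_ofPred_eq, gt_iff_lt] at hω ⊢
          linarith
      _ ≤ 2 * Real.exp (-t ^ 2 / 8) := h1
      _ ≤ 4 * Real.exp (-t ^ 2 / 8) := by gcongr; norm_num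
  · have hKpos : 0 < K := by
      obtain ⟨f, hf, hfn⟩ := exists_dual_vector'' 𝕜 (x n)
      refine lt_of_lt_of_le (kFunctional12_pos (hweak f) ht (n := n) ?_) (le_ciSup hb ⟨f, hf⟩)
      rw [hfn]
      exact_mod_cast norm_ne_zero_iff.2 hn
    rcases le_or_gt e (K / 27) with hcase | hcase
    -- the mean is negligible: a functional whose K-functional exceeds `26 / 27 * K` gives the
    -- bound, as `K / 27 < (26 / 27 * K) / 25`
    · have : Nonempty {f : StrongDual 𝕜 E // ‖f‖ ≤ 1} := ⟨⟨0, by simp⟩⟩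
      obtain ⟨⟨f, hf⟩, hfK⟩ := exists_lt_of_lt_ciSup (show 26 / 27 * K < _ by
        change _ < weakKFunctional12 𝕜 x t; linarith)
      simp only at hfK
      have hfpos : 0 < kFunctional12 (fun n => f (x n)) t := by linarith
      obtain ⟨N, hN⟩ := hε.exists_le_measureReal_norm_gt hf (hweak f) ht.le hfpos
      have h1 : (3 / 32 : ℝ) ^ (⌈t ^ 2⌉₊ + 1) / 2 ≤ P.real {ω | K / 27 < ‖X ω‖} := by
        refine le_measureReal_gt_of_tendsto hm hlim
          (s := kFunctional12 (fun n => f (x n)) t / 25) (by linarith) (N₀ := N) fun M hM => ?_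
        linarith [hε.measureReal_norm_gt_le x hM (kFunctional12 (fun n => f (x n)) t / 25)]
      have h2 := exp_le_pow_ceil (t ^ 2) (sq_nonneg t)
      have h3 : 1 / 100000 * Real.exp (-t ^ 2 / (1 / 100000)) ≤ Real.exp (-(3 * t ^ 2 + 6)) / 2 := by
        have h4 : (1 : ℝ) / 50000 ≤ Real.exp (-6) := by
          rw [Real.exp_neg, ← one_div]
          have h5 : Real.exp 6 = Real.exp 1 ^ 6 := by rw [← Real.exp_nat_mul]; norm_num
          have h6 : Real.exp 1 ^ 6 ≤ 3 ^ 6 := by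
            gcongr
            exact (Real.exp_one_lt_d9.trans (by norm_num)).le
          refine one_div_le_one_div_of_le (Real.exp_pos _) ?_
          rw [h5]
          exact h6.trans (by norm_num)
        have h7 : Real.exp (-t ^ 2 / (1 / 100000)) ≤ Real.exp (-(3 * t ^ 2)) := by
          rw [Real.exp_le_exp]
          linarith [sq_nonneg t]
        rw [neg_add, Real.exp_add]
        have := mul_le_mul h7 h4 (by positivity) (Real.exp_pos _).le
        linarith
      have h8 : P.real {ω | K / 27 < ‖X ω‖} ≤
          P.real {ω | ‖X ω‖ > 1 / 2 * e + 1 / 100000 * K} := by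
        refine measureReal_mono fun ω hω => ?_
        simp only [Set.mem_ofPred_eq, gt_iff_lt] at hω ⊢
        linarith
      linarith
    -- the mean dominates: Paley–Zygmund, with the second moment controlled by the mean
    · have he0 : 0 < e := by linarith
      -- `6` makes the probability in Markov's inequality smaller than `3 / 16`
      have h1 : ∀ N, P.real {ω | 6 * e < ‖∑ n ∈ Finset.range N, ε n ω • x n‖} < 3 / 16 := by
        intro N
        have h2 := mul_meas_ge_le_integral_of_nonneg
          (ae_of_all P fun ω => norm_nonneg (∑ n ∈ Finset.range N, ε n ω • x n)) (hi N) (6 * e)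
        have h3 : P.real {ω | 6 * e < ‖∑ n ∈ Finset.range N, ε n ω • x n‖} ≤
            P.real {ω | 6 * e ≤ ‖∑ n ∈ Finset.range N, ε n ω • x n‖} :=
          by
          refine measureReal_mono fun ω hω => ?_
          simp only [Set.mem_ofPred_eq] at hω ⊢
          exact hω.le
        have h4 : P.real {ω | 6 * e ≤ ‖∑ n ∈ Finset.range N, ε n ω • x n‖} ≤ 1 / 6 := by
          refine le_of_mul_le_mul_left (a := 6 * e) ?_ (by positivity)
          linarith [hle N]
        linarith
      obtain ⟨-, h2⟩ := integrable_sq_of_tendsto hm hi2 hlim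
        fun N => hε.integral_norm_sq_le_of_measureReal_lt x N (h1 N)
      -- `4680 = 130 * 6²`
      have h3 := le_measureReal_gt_three_quarters (C := 4680) hXm hXi hX2 he.symm he0
        (by norm_num) (h2.trans (le_of_eq (by ring)))
      have h4 : P.real {ω | 3 / 4 * e < ‖X ω‖} ≤
          P.real {ω | ‖X ω‖ > 1 / 2 * e + 1 / 100000 * K} := by
        refine measureReal_mono fun ω hω => ?_
        simp only [Set.mem_ofPred_eq, gt_iff_lt] at hω ⊢
        linarith
      have h5 : Real.exp (-t ^ 2 / (1 / 100000)) ≤ 1 := by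
        rw [Real.exp_le_one_iff]
        have := sq_nonneg t
        linarith
      norm_num at h3
      linarith

end Assembly

theorem mainTheorem1 :
    ∃ c : ℝ, 0 < c ∧
      ∀ (𝕜 : Type*) [RCLike 𝕜] (E : Type*) [NormedAddCommGroup E] [NormedSpace 𝕜 E]
        [CompleteSpace E] (Ω : Type*) [MeasurableSpace Ω] (P : Measure Ω)
        [IsProbabilityMeasure P] (ε : ℕ → Ω → ℝ) (x : ℕ → E) (X : Ω → E),
        IsRademacherSequence P ε → IsRademacherSum 𝕜 P ε x X →
          Integrable (fun ω => ‖X ω‖) P ∧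
          IsWeaklyL2 𝕜 x ∧
          ∀ t : ℝ, 0 < t →
            BddAbove (Set.range fun f : {f : StrongDual 𝕜 E // ‖f‖ ≤ 1} =>
              kFunctional12 (fun n => f.1 (x n)) t) ∧
            P.real {ω | ‖X ω‖ > 2 * (∫ ω', ‖X ω'‖ ∂P) + 6 * weakKFunctional12 𝕜 x t}
              ≤ 4 * Real.exp (-t ^ 2 / 8) ∧
            ((∃ n, x n ≠ 0) →
              P.real {ω | ‖X ω‖ > 1 / 2 * (∫ ω', ‖X ω'‖ ∂P) + c * weakKFunctional12 𝕜 x t}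
                ≥ c * Real.exp (-t ^ 2 / c)) := by
  refine ⟨1 / 100000, by norm_num, ?_⟩
  intro 𝕜 _ E _ _ _ Ω _ P _ ε x X hε hX
  let _ : NormedSpace ℝ E := NormedSpace.restrictScalars ℝ 𝕜 E
  have : IsScalarTower ℝ 𝕜 E := IsScalarTower.restrictScalars ℝ 𝕜 E
  refine hε.tail_estimates (𝕜 := 𝕜) (X := X) ?_
  unfold IsRademacherSum at hX
  simpa only [RCLike.real_smul_eq_coe_smul (K := 𝕜)] using hX
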